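/- Let $G$ be a simply-connected three-dimensional Lie group with identity $e$, Lie algebra $\mathfrak g=T_eG$ and a left-invariant Riemannian metric $g$. Let $S_e\subseteq\mathfrak g$ be the subspace of all values $X|_e$, where $X$ is a Killing field of $g$ with $(\nabla_YX)|_e=0$ for every vector field $Y$ ($\nabla$ the Levi-Civita connection), and let the index of symmetry be $i(G)=\dim S_e$. Suppose that $\mathfrak g$ is solvable with defining triple $(a,b,c)$, $a\ge 0$, $b\ge|c|$; that is, $\mathfrak g$ has an orthonormal basis $e_1,e_2,e_3$ with $$[e_1,e_2]=ae_2+be_3,\qquad [e_1,e_3]=ce_2+ae_3,\qquad [e_2,e_3]=0 .$$ For $K\in\mathbb R$ let $\mathfrak g(K)$ be the Lie algebra with basis $f_1,f_2,f_3$ and $[f_1,f_2]=f_2+f_3$, $[f_1,f_3]=Kf_2+f_3$, $[f_2,f_3]=0$ (for a triple with $a,b>0$ the algebra is $\mathfrak g(K)$ with $K=bc/a^2$). Let $\mathfrak g_I$, $\mathfrak e(1,1)$, $\mathfrak e(2)$ and the Heisenberg algebra be the Lie algebras with basis $f_1,f_2,f_3$, $[f_2,f_3]=0$ and $([f_1,f_2],[f_1,f_3])$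 equal to $(f_2,f_3)$, $(f_3,f_2)$, $(f_3,-f_2)$ and $(f_3,0)$, respectively. Then, if $(a,b,c)$ is one of the triples in the following table, $\mathfrak g$, $S_e$ and $i(G)$ are as listed (in each row with $\mathfrak g(K)$, $a>0$, $b>0$ and $K=bc/a^2$): 1. $\mathfrak g(K)$, $K>1$, triple $(a,b,b)$: $S_e=\mathrm{span}(e_1)$, $i(G)=1$. 2. $\mathfrak g(1)$, triple $(a,b,b)$: $S_e=\mathfrak g$, $i(G)=3$. 3. $\mathfrak g(1)$, triple $(a,b,c)$ with $b\ne c$: $S_e=\mathrm{span}(ae_2-be_3)$, $i(G)=1$. 4. $\mathfrak g(K)$, $0<K<1$, triple $(a,b,b)$: $S_e=\mathrm{span}(e_1)$, $i(G)=1$. 5. $\mathfrak g(K)$, $0<K<1$, triple $(a,\,a+a\sqrt{1-K},\,a-a\sqrt{1-K})$: $S_e=\mathrm{span}(e_2-e_3)$, $i(G)=1$. 6. $\mathfrak g(0)$, triple $(a,2a,0)$: $S_e=\mathrm{span}(e_2-e_3)$, $i(G)=1$. 7. $\mathfrak g(K)$, $K<0$, triple $(a,b,-b)$: $S_e=\mathfrak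 g$, $i(G)=3$. 8. $\mathfrak g(K)$, $K<0$, triple $(a,\,a+a\sqrt{1-K},\,a-a\sqrt{1-K})$: $S_e=\mathrm{span}(e_2-e_3)$, $i(G)=1$. 9. $\mathfrak g_I$, triple $(a,0,0)$, $a>0$: $S_e=\mathfrak g$, $i(G)=3$. 10. $\mathfrak e(1,1)$, triple $(0,b,b)$, $b>0$: $S_e=\mathrm{span}(e_1)$, $i(G)=1$. 11. Heisenberg algebra, triple $(0,b,0)$, $b>0$: $S_e=\mathrm{span}(e_3)$, $i(G)=1$. 12. $\mathfrak e(2)$, triple $(0,b,-b)$, $b>0$: $S_e=\mathfrak g$, $i(G)=3$. 13. Abelian algebra, triple $(0,0,0)$: $S_e=\mathfrak g$, $i(G)=3$. For every other triple $S_e=0$ and $i(G)=0$. In particular $i(G)>0$ exactly for the triples listed. -/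

import Mathlib

open Bundle VectorField Module
open scoped Manifold ContDiff

noncomputable section

namespace SymIndex

section Riemannian

variable {n : ℕ} {M : Type*} [TopologicalSpace M] [ChartedSpace (EuclideanSpace ℝ (Fin n)) M]
  [IsManifold (𝓡 n) ∞ M]

/-- Smooth vector fields on the smooth `n`-manifold `M`. -/
abbrev SmoothVF (n : ℕ) (M : Type*) [TopologicalSpace M]
    [ChartedSpace (EuclideanSpace ℝ (Fin n)) M] [IsManifold (𝓡 n) ∞ M] : Type _ :=
  ContMDiffSection (𝓡 n) (EuclideanSpace ℝ (Fin n)) ∞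
    (fun x : M => TangentSpace (𝓡 n) x)

/-- Smooth Riemannian metrics on the smooth `n`-manifold `M`. -/
abbrev SmoothMetric (n : ℕ) (M : Type*) [TopologicalSpace M]
    [ChartedSpace (EuclideanSpace ℝ (Fin n)) M] [IsManifold (𝓡 n) ∞ M] : Type _ :=
  ContMDiffRiemannianMetric (𝓡 n) ∞ (EuclideanSpace ℝ (Fin n))
    (fun x : M => TangentSpace (𝓡 n) x)

/-- The function `x ↦ g_x(Y_x, Z_x)`. -/
def pairing (g : SmoothMetric n M) (Y Z : SmoothVF n M) (x : M) : ℝ :=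
  g.inner x (Y x) (Z x)

/-- `X` is a Killing field: the Lie derivative `L_X g` vanishes, that is,
`X(g(Y, Z)) = g([X, Y], Z) + g(Y, [X, Z])` for all smooth vector fields `Y`, `Z`. -/
def IsKilling (g : SmoothMetric n M) (X : SmoothVF n M) : Prop :=
  ∀ (Y Z : SmoothVF n M) (x : M),
    mvfderiv (𝓡 n) (pairing g Y Z) x (X x) =
      g.inner x (mlieBracket (𝓡 n) X Y x) (Z x) + g.inner x (Y x) (mlieBracket (𝓡 n) X Z x)

/-- The right-hand side of the Koszul formula: the value at `x` of `2 g(∇_Y X, Z)`, where `∇` is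
the Levi-Civita connection of `g`. -/
def koszul (g : SmoothMetric n M) (Y X Z : SmoothVF n M) (x : M) : ℝ :=
  mvfderiv (𝓡 n) (pairing g X Z) x (Y x) + mvfderiv (𝓡 n) (pairing g Y Z) x (X x)
    - mvfderiv (𝓡 n) (pairing g Y X) x (Z x)
    + g.inner x (mlieBracket (𝓡 n) Y X x) (Z x) - g.inner x (mlieBracket (𝓡 n) Y Z x) (X x)
    - g.inner x (mlieBracket (𝓡 n) X Z x) (Y x)

/-- `X` is parallel at `p`: `(∇_Y X)_p = 0` for every smooth vector field `Y`, where `∇` is the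
Levi-Civita connection of `g`. -/
def IsParallelAt (g : SmoothMetric n M) (X : SmoothVF n M) (p : M) : Prop :=
  ∀ Y Z : SmoothVF n M, koszul g Y X Z p = 0

theorem SmoothVF.mdifferentiableAt (X : SmoothVF n M) (x : M) :
    MDifferentiableAt (𝓡 n) (𝓡 n).tangent
      (fun y => (⟨y, X y⟩ : TangentBundle (𝓡 n) M)) x :=
  X.contMDiff.mdifferentiableAt (by simp)

theorem mdifferentiableAt_pairing (g : SmoothMetric n M) (Y Z : SmoothVF n M) (x : M) :
    MDifferentiableAt (𝓡 n) 𝓘(ℝ) (pairing g Y Z) x := by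
  have : MDifferentiableAt (𝓡 n) ((𝓡 n).prod 𝓘(ℝ))
      (fun m => TotalSpace.mk' ℝ (E := Bundle.Trivial M ℝ) m (g.inner m (Y m) (Z m))) x := by
    apply MDifferentiableAt.clm_bundle_apply₂ (F₁ := EuclideanSpace ℝ (Fin n))
      (F₂ := EuclideanSpace ℝ (Fin n))
    · exact g.contMDiff.mdifferentiableAt (by simp)
    · exact Y.mdifferentiableAt x
    · exact Z.mdifferentiableAt x
  simp only [mdifferentiableAt_totalSpace] at this
  exact this.2

theorem pairing_comm (g : SmoothMetric n M) (Y Z : SmoothVF n M) :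
    pairing g Y Z = pairing g Z Y := funext fun x => g.symm x _ _

/-- Any torsion-free covariant derivative compatible with `g` satisfies the Koszul formula. -/
theorem koszul_eq (g : SmoothMetric n M)
    (cov : CovariantDerivative (𝓡 n) (EuclideanSpace ℝ (Fin n))
      (fun x : M => TangentSpace (𝓡 n) x))
    (htor : ∀ (X Y : SmoothVF n M) (x : M),
      cov Y x (X x) - cov X x (Y x) = mlieBracket (𝓡 n) X Y x)
    (hmet : ∀ (X Y Z : SmoothVF n M) (x : M), mvfderiv (𝓡 n) (pairing g Y Z) x (X x) =
      g.inner x (cov Y x (X x)) (Z x) + g.inner x (Y x) (cov Z x (X x)))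
    (Y X Z : SmoothVF n M) (x : M) :
    koszul g Y X Z x = 2 * g.inner x (cov X x (Y x)) (Z x) := by
  unfold koszul
  rw [← htor, ← htor, ← htor, hmet, hmet, hmet]
  simp only [map_sub, sub_apply]
  rw [g.symm x (X x), g.symm x (Y x), g.symm x (Y x)]
  ring

theorem pairing_add_left (g : SmoothMetric n M) (X X' Z : SmoothVF n M) :
    pairing g (X + X') Z = pairing g X Z + pairing g X' Z := by
  funext x; simp [pairing]

theorem pairing_smul_left (g : SmoothMetric n M) (c : ℝ) (X Z : SmoothVF n M) :
    pairing g (c • X) Z = (fun _ : M => c) • pairing g X Z := by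
  funext x; simp [pairing]

theorem pairing_zero_left (g : SmoothMetric n M) (Z : SmoothVF n M) :
    pairing g 0 Z = 0 := by
  funext x; simp [pairing]

theorem mlieBracket_add (X X' Y : SmoothVF n M) (x : M) :
    mlieBracket (𝓡 n) (⇑(X + X')) Y x
      = mlieBracket (𝓡 n) X Y x + mlieBracket (𝓡 n) X' Y x := by
  rw [ContMDiffSection.coe_add]
  exact mlieBracket_add_left (X.mdifferentiableAt x) (X'.mdifferentiableAt x)

theorem mlieBracket_smul (c : ℝ) (X Y : SmoothVF n M) (x : M) :
    mlieBracket (𝓡 n) (⇑(c • X)) Y x = c • mlieBracket (𝓡 n) X Y x := by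
  rw [ContMDiffSection.coe_smul]
  exact mlieBracket_const_smul_left (X.mdifferentiableAt x)

theorem IsKilling.add {g : SmoothMetric n M} {X X' : SmoothVF n M}
    (h : IsKilling g X) (h' : IsKilling g X') : IsKilling g (X + X') := by
  intro Y Z x
  rw [mlieBracket_add, mlieBracket_add]
  simp only [ContMDiffSection.coe_add, Pi.add_apply, map_add, add_apply,
    h Y Z x, h' Y Z x]
  ring

theorem IsKilling.smul {g : SmoothMetric n M} (c : ℝ) {X : SmoothVF n M}
    (h : IsKilling g X) : IsKilling g (c • X) := by
  intro Y Z x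
  rw [mlieBracket_smul, mlieBracket_smul]
  simp only [ContMDiffSection.coe_smul, Pi.smul_apply, map_smul, smul_apply,
    h Y Z x, smul_eq_mul]
  ring

theorem koszul_add (g : SmoothMetric n M) (Y X X' Z : SmoothVF n M) (x : M) :
    koszul g Y (X + X') Z x = koszul g Y X Z x + koszul g Y X' Z x := by
  unfold koszul
  rw [pairing_comm g Y (X + X'), mlieBracket_swap_apply (V := ⇑Y) (W := ⇑(X + X')),
    mlieBracket_add, mlieBracket_add, pairing_add_left, pairing_add_left,
    mvfderiv_add (mdifferentiableAt_pairing g _ _ x) (mdifferentiableAt_pairing g _ _ x),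
    mvfderiv_add (mdifferentiableAt_pairing g _ _ x) (mdifferentiableAt_pairing g _ _ x),
    pairing_comm g Y X, pairing_comm g Y X', mlieBracket_swap_apply (V := ⇑Y) (W := ⇑X),
    mlieBracket_swap_apply (V := ⇑Y) (W := ⇑X')]
  simp only [ContMDiffSection.coe_add, Pi.add_apply, map_add, map_neg, neg_add,
    add_apply]
  ring

theorem koszul_smul (g : SmoothMetric n M) (c : ℝ) (Y X Z : SmoothVF n M) (x : M) :
    koszul g Y (c • X) Z x = c * koszul g Y X Z x := by
  unfold koszul
  rw [pairing_comm g Y (c • X), mlieBracket_swap_apply (V := ⇑Y) (W := ⇑(c • X)),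
    mlieBracket_smul, mlieBracket_smul, pairing_smul_left, pairing_smul_left,
    mvfderiv_smul mdifferentiableAt_const (mdifferentiableAt_pairing g _ _ x),
    mvfderiv_smul mdifferentiableAt_const (mdifferentiableAt_pairing g _ _ x),
    pairing_comm g Y X, mlieBracket_swap_apply (V := ⇑Y) (W := ⇑X), mvfderiv_const]
  simp
  ring

/-- The subspace of `T_p M` of all values `X_p`, where `X` is a Killing field of `g` which is
parallel at `p`. -/
def symmetrySubspace (g : SmoothMetric n M) (p : M) : Submodule ℝ (TangentSpace (𝓡 n) p) where
  carrier := {v | ∃ X : SmoothVF n M, IsKilling g X ∧ IsParallelAt g X p ∧ X p = v}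
  add_mem' := by
    rintro _ _ ⟨X, hX, hX', rfl⟩ ⟨Y, hY, hY', rfl⟩
    exact ⟨X + Y, hX.add hY, fun V W => by rw [koszul_add, hX', hY', add_zero], rfl⟩
  zero_mem' := by
    refine ⟨(0 : ℝ) • 0, ?_, fun V W => by rw [koszul_smul, zero_mul], by simp⟩
    refine IsKilling.smul 0 fun Y Z x => ?_
    rw [ContMDiffSection.coe_zero, mlieBracket_zero_left, mlieBracket_zero_left]
    simp
  smul_mem' := by
    rintro c _ ⟨X, hX, hX', rfl⟩
    exact ⟨c • X, hX.smul c, fun V W => by rw [koszul_smul, hX', mul_zero], rfl⟩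

end Riemannian

section LieGroups

variable {G : Type*} [TopologicalSpace G] [ChartedSpace (EuclideanSpace ℝ (Fin 3)) G] [Group G]
  [LieGroup (𝓡 3) ∞ G]

/-- `g` is left-invariant: all left translations are isometries. -/
def IsLeftInvariant (g : SmoothMetric 3 G) : Prop :=
  ∀ (h x : G) (u v : TangentSpace (𝓡 3) x),
    g.inner (h * x) (mfderiv (𝓡 3) (𝓡 3) (fun y => h * y) x u)
      (mfderiv (𝓡 3) (𝓡 3) (fun y => h * y) x v) = g.inner x u v

/-- The index of symmetry `i(G, g)`: the dimension of `S_e`. -/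
def indexOfSymmetry (g : SmoothMetric 3 G) : ℕ :=
  finrank ℝ (symmetrySubspace g (1 : G))

/-- `(e 0, e 1, e 2)` is an orthonormal basis of the Lie algebra of `G` (the tangent space at the
identity) through which the metric Lie algebra of `(G, g)` defines the triple `(a, b, c)`. -/
structure DefinesTriple (g : SmoothMetric 3 G) (e : Fin 3 → GroupLieAlgebra (𝓡 3) G)
    (a b c : ℝ) : Prop where
  a_nonneg : 0 ≤ a
  abs_le : |c| ≤ b
  orthonormal : ∀ i j, g.inner 1 (e i) (e j) = if i = j then 1 else 0
  bracket_01 : ⁅e 0, e 1⁆ = a • e 1 + b • e 2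
  bracket_02 : ⁅e 0, e 2⁆ = c • e 1 + a • e 2
  bracket_12 : ⁅e 1, e 2⁆ = 0

end LieGroups

/-- The isomorphism types of Lie algebras occurring in the classification. -/
inductive AlgebraType
  | gK (K : ℝ)
  | gI
  | e11
  | heisenberg
  | e2
  | abelian

/-- `L` has a basis `f₀, f₁, f₂` with `[f₀, f₁] = p f₁ + q f₂`, `[f₀, f₂] = r f₁ + s f₂` and
`[f₁, f₂] = 0`. -/
def HasBracketBasis (L : Type*) [AddCommGroup L] [Module ℝ L] [Bracket L L] (p q r s : ℝ) : Prop :=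
  ∃ f : Basis (Fin 3) ℝ L, ⁅f 0, f 1⁆ = p • f 1 + q • f 2 ∧ ⁅f 0, f 2⁆ = r • f 1 + s • f 2 ∧
    ⁅f 1, f 2⁆ = 0

/-- `L` is isomorphic to the Lie algebra named by the type. -/
def AlgebraType.IsTypeOf (L : Type*) [AddCommGroup L] [Module ℝ L] [Bracket L L] :
    AlgebraType → Prop
  | gK K => HasBracketBasis L 1 1 K 1
  | gI => HasBracketBasis L 1 0 0 1
  | e11 => HasBracketBasis L 0 1 1 0
  | heisenberg => HasBracketBasis L 0 1 0 0
  | e2 => HasBracketBasis L 0 1 (-1) 0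
  | abelian => HasBracketBasis L 0 0 0 0

/-- The rows of the table: Lie algebra, triple `(a, b, c)`, the subspace `S_e`, and the index.
The basis vectors `e_1, e_2, e_3` are `e 0, e 1, e 2`; for the family `𝔤(K)` one has
`a, b > 0` and `K = b c / a ^ 2`. -/
inductive TableRow {V : Type*} [AddCommGroup V] [Module ℝ V] (e : Fin 3 → V) :
    AlgebraType → ℝ → ℝ → ℝ → Submodule ℝ V → ℕ → Prop
  | gK_gt_one (K a b : ℝ) (hK : 1 < K) (ha : 0 < a) (hb : 0 < b) (h : b * b / a ^ 2 = K) :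
      TableRow e (.gK K) a b b (ℝ ∙ e 0) 1
  | g1_eq (a b : ℝ) (ha : 0 < a) (hb : 0 < b) (h : b * b / a ^ 2 = 1) :
      TableRow e (.gK 1) a b b ⊤ 3
  | g1_ne (a b c : ℝ) (ha : 0 < a) (hb : 0 < b) (hbc : b ≠ c) (h : b * c / a ^ 2 = 1) :
      TableRow e (.gK 1) a b c (ℝ ∙ (a • e 1 - b • e 2)) 1
  | gK_mid_eq (K a b : ℝ) (hK0 : 0 < K) (hK1 : K < 1) (ha : 0 < a) (hb : 0 < b)
      (h : b * b / a ^ 2 = K) :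
      TableRow e (.gK K) a b b (ℝ ∙ e 0) 1
  | gK_mid_sqrt (K a : ℝ) (hK0 : 0 < K) (hK1 : K < 1) (ha : 0 < a) :
      TableRow e (.gK K) a (a + a * √(1 - K)) (a - a * √(1 - K)) (ℝ ∙ (e 1 - e 2)) 1
  | g0 (a : ℝ) (ha : 0 < a) :
      TableRow e (.gK 0) a (2 * a) 0 (ℝ ∙ (e 1 - e 2)) 1
  | gK_neg_opp (K a b : ℝ) (hK : K < 0) (ha : 0 < a) (hb : 0 < b) (h : b * -b / a ^ 2 = K) :
      TableRow e (.gK K) a b (-b) ⊤ 3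
  | gK_neg_sqrt (K a : ℝ) (hK : K < 0) (ha : 0 < a) :
      TableRow e (.gK K) a (a + a * √(1 - K)) (a - a * √(1 - K)) (ℝ ∙ (e 1 - e 2)) 1
  | gI (a : ℝ) (ha : 0 < a) :
      TableRow e .gI a 0 0 ⊤ 3
  | e11 (b : ℝ) (hb : 0 < b) :
      TableRow e .e11 0 b b (ℝ ∙ e 0) 1
  | heisenberg (b : ℝ) (hb : 0 < b) :
      TableRow e .heisenberg 0 b 0 (ℝ ∙ e 2) 1
  | e2 (b : ℝ) (hb : 0 < b) :
      TableRow e .e2 0 b (-b) ⊤ 3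
  | abelian :
      TableRow e .abelian 0 0 0 ⊤ 3

end SymIndex

end

/-! The left-invariant fields `E 0`, `E 1`, `E 2` extending the basis form an orthonormal frame with
constant structure coefficients. Hence X = p E₀ + q E₁ + r E₂ is Killing iff p, q, r satisfy six
first-order equations, and a Killing X is parallel at a point iff its dual 1-form is closed there.
It remains to decide which values of (p, q, r) at the identity occur.

Upper bound. Put s = (b + c)/2 and d = (b - c)/2. The Killing equation is prolonged: all first
derivatives of p, q, r are expressed through p, q, r and the components w₁, w₂, w₃ of ∇X, and the
commutators of the frame then determine all derivatives of the wᵢ. Commutators applied to the wᵢ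
leave algebraic constraints, each with a factor s (`KillingSystem`). For s ≠ 0 these constraints and
their E₀-derivatives, evaluated where the wᵢ vanish, are linear conditions on the value of X
(`KillingSystem.eval_eq_zero`). They force it to be zero unless b = c, b + c = 2a or bc = a². If s =
0 the metric has constant curvature -a² and nothing is constrained.

Lower bound. Simple connectedness makes closed 1-forms exact (`exists_primitive`), which yields a
function τ with dτ dual to E₀ and functions z₁, z₂ dual to E₁, E₂ (`IsCoordinates`). Killing fields
are written down in these: for b = c the right-invariant field of e₀; for b + c = 2a that of e₁ -
e₂; for bc = a² the field of the central vector a e₁ - b e₂, corrected by a Killing field vanishing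
at the point; for c = -b the transvections of hyperbolic or flat 3-space; for a = b = c > 0 the
space is a hyperbolic plane times a line, and a transvection of the plane supplies the missing
direction e₁ + e₂.

Finally, the triples satisfying one of b = c, b + c = 0, b + c = 2a, bc = a² are exactly those in
the table (`exists_tableRow`). -/

section

/-! ### Gluing on simply connected spaces and the Poincaré lemma for a frame -/

open Set Filter Topology

/-- On a simply connected space, locally defined functions with locally constant differences
can be glued, up to locally constant functions, to a global one. -/
theorem exists_glue_of_locallyConst_sub {X A : Type*} [TopologicalSpace X]
    [SimplyConnectedSpace X] [LocallyPathConnectedSpace X] [AddCommGroup A]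
    (U : X → Set X) (hU : ∀ i, IsOpen (U i)) (hmem : ∀ x, x ∈ U x) (F : X → X → A)
    (hF : ∀ i j, ∀ x ∈ U i ∩ U j, ∀ᶠ y in 𝓝 x, F i y - F j y = F i x - F j x) (x₀ : X) :
    ∃ f : X → A, f x₀ = 0 ∧ ∀ x, ∀ᶠ y in 𝓝 x, f y = F x y + (f x - F x x) := by
  let : TopologicalSpace A := ⊥
  have : DiscreteTopology A := ⟨rfl⟩
  -- With A discrete, the bundle with transition functions F i - F j is a covering; the quantity v +
  -- F i x does not depend on the chart i and is the value of the global function to be found.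
  let Z : FiberBundleCore X X A :=
    { baseSet := U
      isOpen_baseSet := hU
      indexAt := id
      mem_baseSet_at := hmem
      coordChange := fun i j x v => v + F i x - F j x
      coordChange_self := fun i x _ v => by abel
      continuousOn_coordChange := fun i j => by
        rintro ⟨x, v⟩ ⟨hx, -⟩
        refine ContinuousAt.continuousWithinAt ?_
        have h1 : ∀ᶠ q : X × A in 𝓝 (x, v), F i q.1 - F j q.1 = F i x - F j x :=
          
          (continuous_fst.continuousAt (x := (x, v))).eventually (hF i j x hx)
        have h2 : ContinuousAt (fun q : X × A => q.2 + (F i x - F j x)) (x, v) :=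
          (continuous_of_discreteTopology (f := fun a : A => a + (F i x - F j x))).continuousAt.comp
            continuousAt_snd
        refine h2.congr (h1.mono fun q hq => ?_)
        simp only
        rw [← hq]; abel
      coordChange_comp := fun i j k x _ v => by abel }
  have hcov : IsCoveringMap (π A Z.Fiber) := FiberBundle.isCoveringMap
  -- A lift of the identity of X is a global section. Starting it at -(F x₀ x₀) normalises the glued
  -- function to vanish at x₀.
  obtain ⟨s, ⟨hs0, hs⟩, -⟩ := hcov.existsUnique_continuousMap_lifts (ContinuousMap.id X) x₀
    (⟨x₀, (-(F x₀ x₀) : A)⟩ : Z.TotalSpace) rfl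
  have hs' : ∀ x, (s x).proj = x := fun x => congrFun hs x
  let σ : X → A := fun x => (s x).2
  -- Read in the trivialisation at x, a section with discrete fibre is locally constant.
  have key : ∀ x, ∀ᶠ y in 𝓝 x, σ y + F y y - F x y = σ x := by
    intro x
    have hc : ContinuousAt (fun y => (Z.localTriv x (s y)).2) x := by
      refine continuous_snd.continuousAt.comp (ContinuousAt.comp ?_ s.continuous.continuousAt)
      refine (Z.localTriv x).continuousOn.continuousAt ((Z.localTriv x).open_source.mem_nhds ?_)
      rw [Z.mem_localTriv_source, hs']
      exact hmem x
    have he : ∀ y, (Z.localTriv x (s y)).2 = σ y + F y y - F x y := by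
      intro y
      have h1 : (Z.localTriv x (s y)).2
        = σ y + F (s y).proj (s y).proj - F x (s y).proj := rfl
      rw [h1, hs']
    have := hc.eventually (IsOpen.mem_nhds (isOpen_discrete {(Z.localTriv x (s x)).2}) rfl)
    refine this.mono fun y hy => ?_
    have hy' : (Z.localTriv x (s y)).2 = (Z.localTriv x (s x)).2 := hy
    rw [he, he] at hy'
    rw [hy']; abel
  refine ⟨fun x => σ x + F x x, ?_, fun x => (key x).mono fun y hy => ?_⟩
  · have : ∀ p : Z.TotalSpace, p = ⟨x₀, (-(F x₀ x₀) : A)⟩ → (p.2 : A) = -(F x₀ x₀) := by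
      rintro _ rfl; rfl
    simp only [σ]
    rw [this _ hs0]; abel
  · simp only
    rw [← hy]; abel

/-- Poincaré lemma in terms of a frame: on an open convex set, functions `f i` satisfying
the integrability conditions are the derivatives along the frame `V i` of a smooth function. -/
theorem Convex.exists_primitive_of_frame {E ι : Type*} [NormedAddCommGroup E] [NormedSpace ℝ E]
    [Fintype ι] [FiniteDimensional ℝ E] {U : Set E} (hU : Convex ℝ U) (hUo : IsOpen U)
    (V : ι → E → E) (hV : ∀ i, ContDiffOn ℝ ∞ (V i) U)
    (hli : ∀ x ∈ U, LinearIndependent ℝ fun i => V i x) (hcard : Fintype.card ι = finrank ℝ E)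
    (f : ι → E → ℝ) (hf : ∀ i, ContDiffOn ℝ ∞ (f i) U) (k : ι → ι → ι → ℝ)
    (hbr : ∀ i j, ∀ x ∈ U, lieBracket ℝ (V i) (V j) x = ∑ l, k i j l • V l x)
    (hcl : ∀ i j, ∀ x ∈ U, fderiv ℝ (f j) x (V i x) - fderiv ℝ (f i) x (V j x)
      = ∑ l, k i j l * f l x) :
    ∃ F : E → ℝ, ContDiffOn ℝ ∞ F U ∧ ∀ x ∈ U, ∀ i, fderiv ℝ F x (V i x) = f i x := by
  classical
  let B : E → (ι → ℝ) →L[ℝ] E := fun x => ∑ i, (ContinuousLinearMap.proj i).smulRight (V i x)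
  let R : E → (ι → ℝ) →L[ℝ] ℝ := fun x => ∑ i, f i x • ContinuousLinearMap.proj i
  have hB : ContDiffOn ℝ ∞ B U := by
    refine ContDiffOn.sum fun i _ => ?_
    exact ((ContinuousLinearMap.smulRightL ℝ (ι → ℝ) E (ContinuousLinearMap.proj i)).contDiff).comp_contDiffOn (hV i)
  have hR : ContDiffOn ℝ ∞ R U :=
    ContDiffOn.sum fun i _ => (hf i).smul contDiffOn_const
  have hBi : ∀ x i, B x (Pi.single i 1) = V i x := by
    intro x i
    simp [B, Pi.single_apply]
  have hBe : ∀ x ∈ U, ∃ e : (ι → ℝ) ≃L[ℝ] E, (e : (ι → ℝ) →L[ℝ] E) = B x := by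
    intro x hx
    let b := basisOfLinearIndependentOfCardEqFinrank' (fun i => V i x) (hli x hx) hcard
    refine ⟨b.equivFun.symm.toContinuousLinearEquiv, ?_⟩
    ext1 v
    change b.equivFun.symm v = B x v
    simp [B, b, Basis.equivFun_symm_apply]
  -- B x sends the standard basis to the frame, so η is the 1-form with η(V i) = f i; it is smooth
  -- because inversion of operators is smooth at isomorphisms.
  let η : E → E →L[ℝ] ℝ := fun x => (R x).comp (B x).inverse
  have hη : ContDiffOn ℝ ∞ η U := by
    refine hR.clm_comp fun x hx => ?_
    obtain ⟨e, he⟩ := hBe x hx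
    have : ContDiffAt ℝ ∞ ContinuousLinearMap.inverse (B x) := he ▸ contDiffAt_map_inverse e
    exact this.comp_contDiffWithinAt x (hB x hx)
  have hηV : ∀ x ∈ U, ∀ i, η x (V i x) = f i x := by
    intro x hx i
    obtain ⟨e, he⟩ := hBe x hx
    have h1 : V i x = e (Pi.single i 1) := by rw [← hBi, ← he]; rfl
    simp only [η, ContinuousLinearMap.comp_apply, ← he, ContinuousLinearMap.inverse_equiv]
    rw [h1]
    simp [R, Pi.single_apply]
  have hηd : DifferentiableOn ℝ η U := hη.differentiableOn (by simp)
  -- This is dη(V i, V j) = V i (f j) - V j (f i) - η([V i, V j]), which the two hypotheses on k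
  -- make zero.
  have hsymV : ∀ x ∈ U, ∀ i j, fderiv ℝ η x (V i x) (V j x) = fderiv ℝ η x (V j x) (V i x) := by
    intro x hx i j
    have hUx := hUo.mem_nhds hx
    have hd : ∀ i j, fderiv ℝ (f j) x (V i x)
        = fderiv ℝ η x (V i x) (V j x) + η x (fderiv ℝ (V j) x (V i x)) := by
      intro i j
      have h1 : f j =ᶠ[𝓝 x] fun y => η y (V j y) :=
        (hUo.eventually_mem hx).mono fun y hy => (hηV y hy j).symm
      rw [h1.fderiv_eq, fderiv_clm_apply (hηd.differentiableAt hUx)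
        (((hV j).differentiableOn (by simp)).differentiableAt hUx)]
      simp [add_comm]
    have h2 := hcl i j x hx
    rw [hd i j, hd j i] at h2
    have h3 : η x (lieBracket ℝ (V i) (V j) x) = ∑ l, k i j l * f l x := by
      rw [hbr i j x hx, map_sum]
      exact Finset.sum_congr rfl fun l _ => by rw [map_smul, hηV x hx, smul_eq_mul]
    rw [lieBracket, map_sub] at h3
    linarith
  have hsym : ∀ x ∈ U, ∀ u v, fderiv ℝ η x u v = fderiv ℝ η x v u := by
    intro x hx u v
    let b := basisOfLinearIndependentOfCardEqFinrank' (fun i => V i x) (hli x hx) hcard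
    have hb : ∀ i, b i = V i x := fun i => by simp [b]
    have : (fderiv ℝ η x).toLinearMap₁₂ = (fderiv ℝ η x).flip.toLinearMap₁₂ := by
      refine LinearMap.ext_basis b b fun i j => ?_
      simpa [hb] using hsymV x hx i j
    exact congrArg (fun L : E →ₗ[ℝ] E →ₗ[ℝ] ℝ => L u v) this
  obtain ⟨F, hF⟩ := hU.exists_forall_hasFDerivAt_of_fderiv_symmetric hUo hηd hsym
  refine ⟨F, ?_, fun x hx i => by rw [(hF x hx).fderiv, hηV x hx]⟩
  rw [contDiffOn_infty_iff_fderiv_of_isOpen hUo]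
  exact ⟨fun x hx => (hF x hx).differentiableAt.differentiableWithinAt,
    hη.congr fun x hx => (hF x hx).fderiv⟩

namespace SymIndex

/-! ### Closed 1-forms on a simply connected manifold with a frame -/

section Primitive

variable {n : ℕ} {M : Type*} [TopologicalSpace M] [ChartedSpace (EuclideanSpace ℝ (Fin n)) M]
  [IsManifold (𝓡 n) ∞ M]

theorem isManifold_minSmoothness_of_infty {m : ℕ} :
    IsManifold (𝓡 n) (minSmoothness ℝ m) M :=
  IsManifold.of_le (n := ∞) (by
    rw [minSmoothness_of_isRCLikeNormedField]
    exact_mod_cast le_top)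

/-- A vector field read in the chart at `x₀`. -/
noncomputable def chartField (x₀ : M) (V : SmoothVF n M) : EuclideanSpace ℝ (Fin n) → EuclideanSpace ℝ (Fin n) :=
  mpullback 𝓘(ℝ, EuclideanSpace ℝ (Fin n)) (𝓡 n) (extChartAt (𝓡 n) x₀).symm V

variable {x₀ : M} {y : EuclideanSpace ℝ (Fin n)}

theorem isInvertible_mfderiv_extChartAt_symm (hy : y ∈ (extChartAt (𝓡 n) x₀).target) :
    (mfderiv 𝓘(ℝ, EuclideanSpace ℝ (Fin n)) (𝓡 n) (extChartAt (𝓡 n) x₀).symm y).IsInvertible := by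
  have : IsManifold (𝓡 n) 1 M := IsManifold.of_le (n := ∞) (by exact_mod_cast le_top)
  have h := isInvertible_mfderivWithin_extChartAt_symm hy
  rwa [ModelWithCorners.range_eq_univ, mfderivWithin_univ] at h

theorem contMDiffAt_extChartAt_symm' (hy : y ∈ (extChartAt (𝓡 n) x₀).target) :
    ContMDiffAt 𝓘(ℝ, EuclideanSpace ℝ (Fin n)) (𝓡 n) ∞ (extChartAt (𝓡 n) x₀).symm y :=
  (contMDiffOn_extChartAt_symm x₀).contMDiffAt ((isOpen_extChartAt_target x₀).mem_nhds hy)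

theorem contDiffAt_chartField (V : SmoothVF n M) (hy : y ∈ (extChartAt (𝓡 n) x₀).target) :
    ContDiffAt ℝ ∞ (chartField x₀ V) y := by
  refine contMDiffAt_vectorSpace_iff_contDiffAt.1 ?_
  exact ContMDiffAt.mpullback_vectorField_preimage (n := ∞) V.contMDiff.contMDiffAt
    (contMDiffAt_extChartAt_symm' hy) (isInvertible_mfderiv_extChartAt_symm hy) (by simp)

theorem mfderiv_chartField (V : SmoothVF n M) (hy : y ∈ (extChartAt (𝓡 n) x₀).target) :
    mfderiv 𝓘(ℝ, EuclideanSpace ℝ (Fin n)) (𝓡 n) (extChartAt (𝓡 n) x₀).symm y (chartField x₀ V y)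
      = V ((extChartAt (𝓡 n) x₀).symm y) :=
  (isInvertible_mfderiv_extChartAt_symm hy).self_apply_inverse _

theorem fderiv_comp_chart (V : SmoothVF n M) (hy : y ∈ (extChartAt (𝓡 n) x₀).target) {h : M → ℝ}
    (hh : MDifferentiableAt (𝓡 n) 𝓘(ℝ) h ((extChartAt (𝓡 n) x₀).symm y)) :
    fderiv ℝ (h ∘ (extChartAt (𝓡 n) x₀).symm) y (chartField x₀ V y)
      = mvfderiv (𝓡 n) h ((extChartAt (𝓡 n) x₀).symm y) (V ((extChartAt (𝓡 n) x₀).symm y)) := by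
  have h1 := mvfderiv_comp_apply y hh
    ((contMDiffAt_extChartAt_symm' hy).mdifferentiableAt (by simp)) (chartField x₀ V y)
  rw [mfderiv_chartField V hy] at h1
  rw [← h1, mvfderiv, mfderiv_eq_fderiv]
  rfl

theorem lieBracket_chartField (V W : SmoothVF n M) (hy : y ∈ (extChartAt (𝓡 n) x₀).target) :
    lieBracket ℝ (chartField x₀ V) (chartField x₀ W) y
      = mpullback 𝓘(ℝ, EuclideanSpace ℝ (Fin n)) (𝓡 n) (extChartAt (𝓡 n) x₀).symm
          (mlieBracket (𝓡 n) V W) y := by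
  have : IsManifold (𝓡 n) (minSmoothness ℝ 3) M := isManifold_minSmoothness_of_infty (m := 3)
  rw [mpullback_mlieBracket (n := ∞) (V.mdifferentiableAt _) (W.mdifferentiableAt _)
    (contMDiffAt_extChartAt_symm' hy) (by
      rw [minSmoothness_of_isRCLikeNormedField]; exact WithTop.coe_le_coe.2 le_top)]
  simp only [← mlieBracketWithin_univ, ← lieBracketWithin_univ, mlieBracketWithin_eq_lieBracketWithin]
  rfl

theorem linearIndependent_chartField (V : Fin n → SmoothVF n M)
    (hli : ∀ x, LinearIndependent ℝ fun i => V i x) (hy : y ∈ (extChartAt (𝓡 n) x₀).target) :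
    LinearIndependent ℝ fun i => chartField x₀ (V i) y := by
  refine LinearIndependent.of_comp (mfderiv 𝓘(ℝ, EuclideanSpace ℝ (Fin n)) (𝓡 n)
    (extChartAt (𝓡 n) x₀).symm y).toLinearMap ?_
  convert! hli ((extChartAt (𝓡 n) x₀).symm y) with i
  exact mfderiv_chartField (V i) hy

/-- A differentiable function with vanishing differential near a point is locally constant. -/
theorem eventually_eq_of_mfderiv_frame_eq_zero (V : Fin n → SmoothVF n M)
    (hli : ∀ x, LinearIndependent ℝ fun i => V i x) {U : Set M} (hU : IsOpen U) (hx : x₀ ∈ U)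
    {h : M → ℝ} (hh : ∀ x ∈ U, MDifferentiableAt (𝓡 n) 𝓘(ℝ) h x)
    (h0 : ∀ x ∈ U, ∀ i, mvfderiv (𝓡 n) h x (V i x) = 0) : ∀ᶠ y in 𝓝 x₀, h y = h x₀ := by
  set φ := extChartAt (𝓡 n) x₀ with hφ
  have hopen : IsOpen (φ.target ∩ φ.symm ⁻¹' U) :=
    (continuousOn_extChartAt_symm x₀).isOpen_inter_preimage (isOpen_extChartAt_target x₀) hU
  have hmem : φ x₀ ∈ φ.target ∩ φ.symm ⁻¹' U :=
    ⟨mem_extChartAt_target x₀, by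
      rw [mem_preimage, hφ, extChartAt_to_inv]; exact hx⟩
  obtain ⟨r, hr, hball⟩ := Metric.isOpen_iff.1 hopen _ hmem
  have hd : ∀ y ∈ Metric.ball (φ x₀) r, DifferentiableAt ℝ (h ∘ φ.symm) y := fun y hy =>
    ((hh _ (hball hy).2).comp y
      ((contMDiffAt_extChartAt_symm' (hball hy).1).mdifferentiableAt (by simp))).differentiableAt
  have hz : ∀ y ∈ Metric.ball (φ x₀) r, fderiv ℝ (h ∘ φ.symm) y = 0 := by
    intro y hy
    have hy' := (hball hy).1
    let b := basisOfLinearIndependentOfCardEqFinrank' (fun i => chartField x₀ (V i) y)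
      (linearIndependent_chartField V hli hy') (by simp)
    refine ContinuousLinearMap.coe_injective (b.ext fun i => ?_)
    have := fderiv_comp_chart (V i) hy' (hh _ (hball hy).2)
    rw [h0 _ (hball hy).2] at this
    have hbi : b i = chartField x₀ (V i) y := by simp [b]
    rw [hbi]
    exact this
  have hconst : ∀ y ∈ Metric.ball (φ x₀) r, h (φ.symm y) = h x₀ := by
    intro y hy
    have := Metric.isOpen_ball.is_const_of_fderiv_eq_zero
      (convex_ball (φ x₀) r).isPreconnected (fun y hy => (hd y hy).differentiableWithinAt) hz hy
      (Metric.mem_ball_self hr)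
    simpa [hφ] using this
  filter_upwards [(continuousAt_extChartAt x₀).preimage_mem_nhds (Metric.ball_mem_nhds (φ x₀) hr),
    extChartAt_source_mem_nhds (I := 𝓡 n) x₀] with y hy hy'
  have := hconst _ hy
  rwa [hφ, PartialEquiv.left_inv _ hy'] at this

/-- The frame is pulled back to a ball in the chart at x₀. Brackets and derivatives are natural
under pullback, so the same constants k satisfy the hypotheses of the Poincaré lemma there. -/
theorem exists_local_primitive (V : Fin n → SmoothVF n M)
    (hli : ∀ x, LinearIndependent ℝ fun i => V i x) (k : Fin n → Fin n → Fin n → ℝ)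
    (hbr : ∀ i j x, mlieBracket (𝓡 n) (V i) (V j) x = ∑ l, k i j l • V l x)
    (f : Fin n → M → ℝ) (hf : ∀ i, ContMDiff (𝓡 n) 𝓘(ℝ) ∞ (f i))
    (hcl : ∀ i j x, mvfderiv (𝓡 n) (f j) x (V i x) - mvfderiv (𝓡 n) (f i) x (V j x)
      = ∑ l, k i j l * f l x) (x₀ : M) :
    ∃ U : Set M, IsOpen U ∧ x₀ ∈ U ∧ ∃ F : M → ℝ, ContMDiffOn (𝓡 n) 𝓘(ℝ) ∞ F U ∧
      ∀ x ∈ U, ∀ i, mvfderiv (𝓡 n) F x (V i x) = f i x := by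
  set φ := extChartAt (𝓡 n) x₀ with hφ
  have hfd : ∀ i x, MDifferentiableAt (𝓡 n) 𝓘(ℝ) (f i) x := fun i x =>
    (hf i).mdifferentiableAt (by simp)
  obtain ⟨r, hr, hball⟩ := Metric.isOpen_iff.1 (isOpen_extChartAt_target (I := 𝓡 n) x₀) _
    (mem_extChartAt_target x₀)
  obtain ⟨F, hF, hFV⟩ := (convex_ball (φ x₀) r).exists_primitive_of_frame Metric.isOpen_ball
    (fun i => chartField x₀ (V i))
    (fun i y hy => (contDiffAt_chartField (V i) (hball hy)).contDiffWithinAt)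
    (fun y hy => linearIndependent_chartField V hli (hball hy)) (by simp)
    (fun i => f i ∘ φ.symm)
    (fun i y hy => ((hf i).contMDiffAt.comp y
      (contMDiffAt_extChartAt_symm' (hball hy))).contDiffAt.contDiffWithinAt) k
    (fun i j y hy => by
      have h1 : mpullback 𝓘(ℝ, EuclideanSpace ℝ (Fin n)) (𝓡 n) φ.symm
          (mlieBracket (𝓡 n) (V i) (V j)) y = ∑ l, k i j l • chartField x₀ (V l) y := by
        rw [mpullback_apply, hbr, map_sum]
        exact Finset.sum_congr rfl fun l _ => map_smul _ _ _
      rw [← h1]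
      exact lieBracket_chartField (V i) (V j) (hball hy))
    (fun i j y hy => by
      rw [fderiv_comp_chart (V i) (hball hy) (hfd _ _),
        fderiv_comp_chart (V j) (hball hy) (hfd _ _), hcl]
      rfl)
  have hopen : IsOpen (φ.source ∩ φ ⁻¹' Metric.ball (φ x₀) r) :=
    (continuousOn_extChartAt x₀).isOpen_inter_preimage (isOpen_extChartAt_source x₀)
      Metric.isOpen_ball
  have hsm : ContMDiffOn (𝓡 n) 𝓘(ℝ) ∞ (F ∘ φ) (φ.source ∩ φ ⁻¹' Metric.ball (φ x₀) r) :=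
    hF.contMDiffOn.comp ((contMDiffOn_extChartAt (x := x₀)).mono fun x hx => by
      simpa [hφ] using hx.1) fun x hx => hx.2
  refine ⟨_, hopen, ⟨mem_extChartAt_source x₀, Metric.mem_ball_self hr⟩, F ∘ φ, hsm,
    fun x hx i => ?_⟩
  have hxt := hball hx.2
  have hxi : φ.symm (φ x) = x := φ.left_inv hx.1
  have h1 := fderiv_comp_chart (V i) hxt (h := F ∘ φ) (by
    rw [← hφ, hxi]
    exact (hsm.contMDiffAt (hopen.mem_nhds hx)).mdifferentiableAt (by simp))
  rw [← hφ, hxi] at h1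
  rw [← h1]
  have h2 : (F ∘ φ) ∘ φ.symm =ᶠ[𝓝 (φ x)] F := by
    filter_upwards [Metric.isOpen_ball.mem_nhds hx.2] with y hy
    simp only [Function.comp_apply]
    rw [φ.right_inv (hball hy)]
  rw [h2.fderiv_eq, hFV _ hx.2 i, Function.comp_apply, hxi]

/-- On a simply connected manifold with a frame satisfying constant-coefficient bracket relations,
functions satisfying the integrability conditions are the derivatives along the frame of a smooth
function: closed `1`-forms are exact. -/
theorem exists_primitive [SimplyConnectedSpace M] (V : Fin n → SmoothVF n M)
    (hli : ∀ x, LinearIndependent ℝ fun i => V i x) (k : Fin n → Fin n → Fin n → ℝ)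
    (hbr : ∀ i j x, mlieBracket (𝓡 n) (V i) (V j) x = ∑ l, k i j l • V l x)
    (f : Fin n → M → ℝ) (hf : ∀ i, ContMDiff (𝓡 n) 𝓘(ℝ) ∞ (f i))
    (hcl : ∀ i j x, mvfderiv (𝓡 n) (f j) x (V i x) - mvfderiv (𝓡 n) (f i) x (V j x)
      = ∑ l, k i j l * f l x) (x₀ : M) :
    ∃ F : M → ℝ, ContMDiff (𝓡 n) 𝓘(ℝ) ∞ F ∧ F x₀ = 0 ∧
      ∀ x i, mvfderiv (𝓡 n) F x (V i x) = f i x := by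
  have : LocallyPathConnectedSpace M :=
    ChartedSpace.locallyPathConnectedSpace (EuclideanSpace ℝ (Fin n)) M
  choose U hU hmem F hF hFV using exists_local_primitive V hli k hbr f hf hcl
  have hFd : ∀ i, ∀ x ∈ U i, MDifferentiableAt (𝓡 n) 𝓘(ℝ) (F i) x := fun i x hx =>
    ((hF i).contMDiffAt ((hU i).mem_nhds hx)).mdifferentiableAt (by simp)
  obtain ⟨s, hs0, hs⟩ := exists_glue_of_locallyConst_sub U hU hmem F (fun i j x hx => by
    refine eventually_eq_of_mfderiv_frame_eq_zero (h := F i - F j) V hli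
      ((hU i).inter (hU j)) hx
      (fun y hy => (hFd i y hy.1).sub (hFd j y hy.2)) fun y hy l => ?_
    rw [mvfderiv_sub (hFd i y hy.1) (hFd j y hy.2), sub_apply, hFV i y hy.1, hFV j y hy.2,
      sub_self]) x₀
  have hs' : ∀ x, s =ᶠ[𝓝 x] F x + fun _ => s x - F x x := fun x => hs x
  refine ⟨s, fun x => ?_, hs0, fun x i => ?_⟩
  · exact (((hF x).contMDiffAt ((hU x).mem_nhds (hmem x))).add contMDiffAt_const).congr_of_eventuallyEq
      (hs' x)
  · have h1 : mvfderiv (𝓡 n) s x = mvfderiv (𝓡 n) (F x + fun _ => s x - F x x) x := by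
      rw [mvfderiv, (hs' x).mfderiv_eq]
      rfl
    rw [h1, mvfderiv_add (hFd x x (hmem x)) mdifferentiableAt_const, mvfderiv_const, add_zero,
      hFV x x (hmem x)]

end Primitive

/-! ### Killing and parallel fields in an orthonormal frame -/

section Frame

variable {n : ℕ} {M : Type*} [TopologicalSpace M] [ChartedSpace (EuclideanSpace ℝ (Fin n)) M]
  [IsManifold (𝓡 n) ∞ M]

variable (n M) in
/-- The algebra of smooth real functions on `M`. -/
abbrev SmoothFun : Type _ := C^∞⟮𝓡 n, M; 𝓘(ℝ), ℝ⟯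

omit [IsManifold (𝓡 n) ∞ M] in
theorem SmoothFun.mdifferentiableAt (f : SmoothFun n M) (x : M) :
    MDifferentiableAt (𝓡 n) 𝓘(ℝ) f x :=
  f.contMDiff.mdifferentiableAt (by simp)

omit [IsManifold (𝓡 n) ∞ M] in
theorem SmoothFun.sum_apply {ι : Type*} (s : Finset ι) (f : ι → SmoothFun n M) (x : M) :
    (∑ i ∈ s, f i) x = ∑ i ∈ s, f i x := by
  classical
  induction s using Finset.induction_on with
  | empty => rfl
  | insert i s hi ih => rw [Finset.sum_insert hi, Finset.sum_insert hi, ← ih]; rfl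

theorem contMDiff_mvfderiv_apply (X : SmoothVF n M) (f : SmoothFun n M) :
    ContMDiff (𝓡 n) 𝓘(ℝ) ∞ fun x => mvfderiv (𝓡 n) f x (X x) := by
  have h1 : ContMDiff (𝓡 n).tangent 𝓘(ℝ).tangent ∞ (tangentMap (𝓡 n) 𝓘(ℝ) f) :=
    f.contMDiff.contMDiff_tangentMap (by simp)
  exact (contMDiff_snd_tangentBundle_modelSpace ℝ 𝓘(ℝ)).comp (h1.comp X.contMDiff)

/-- A vector field as a derivation of the algebra of smooth functions. -/
noncomputable def SmoothVF.toDerivation (X : SmoothVF n M) :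
    Derivation ℝ (SmoothFun n M) (SmoothFun n M) where
  toFun f := ⟨fun x => mvfderiv (𝓡 n) f x (X x), contMDiff_mvfderiv_apply X f⟩
  map_add' f h := by
    ext x
    change mvfderiv (𝓡 n) (⇑f + ⇑h) x (X x) = _
    rw [mvfderiv_add (f.mdifferentiableAt x) (h.mdifferentiableAt x)]
    rfl
  map_smul' c f := by
    ext x
    change mvfderiv (𝓡 n) ((fun _ : M => c) • ⇑f) x (X x) = c * mvfderiv (𝓡 n) f x (X x)
    rw [mvfderiv_smul mdifferentiableAt_const (f.mdifferentiableAt x), mvfderiv_const]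
    simp
  map_one_eq_zero' := by
    ext x
    change mvfderiv (𝓡 n) (fun _ : M => (1 : ℝ)) x (X x) = 0
    rw [mvfderiv_const]
    rfl
  leibniz' f h := by
    ext x
    change mvfderiv (𝓡 n) (⇑f * ⇑h) x (X x)
      = f x * mvfderiv (𝓡 n) h x (X x) + h x * mvfderiv (𝓡 n) f x (X x)
    rw [mvfderiv_mul (f.mdifferentiableAt x) (h.mdifferentiableAt x)]
    simp

theorem toDerivation_apply (X : SmoothVF n M) (f : SmoothFun n M) (x : M) :
    X.toDerivation f x = mvfderiv (𝓡 n) f x (X x) := rfl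

/-- The smooth function `x ↦ g_x(X_x, Y_x)`. -/
noncomputable def pairingFun (g : SmoothMetric n M) (X Y : SmoothVF n M) : SmoothFun n M :=
  ⟨pairing g X Y, by
    have : ContMDiff (𝓡 n) ((𝓡 n).prod 𝓘(ℝ)) ∞
        (fun m : M => TotalSpace.mk' ℝ (E := Bundle.Trivial M ℝ) m (g.inner m (X m) (Y m))) := by
      apply ContMDiff.clm_bundle_apply₂ (F₁ := EuclideanSpace ℝ (Fin n))
        (F₂ := EuclideanSpace ℝ (Fin n))
      · exact g.contMDiff
      · exact X.contMDiff
      · exact Y.contMDiff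
    intro x
    exact ((contMDiffAt_totalSpace.1 (this x)).2)⟩

theorem pairingFun_apply (g : SmoothMetric n M) (X Y : SmoothVF n M) (x : M) :
    pairingFun g X Y x = g.inner x (X x) (Y x) := rfl

/-- The field `∑ i, x i • E i`. -/
noncomputable def combination (E : Fin n → SmoothVF n M) (f : Fin n → SmoothFun n M) : SmoothVF n M :=
  ⟨fun x => ∑ i, f i x • E i x, ContMDiff.sum_section fun i _ =>
    ContMDiff.smul_section (f i).contMDiff (E i).contMDiff⟩

theorem combination_apply (E : Fin n → SmoothVF n M) (f : Fin n → SmoothFun n M) (x : M) :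
    combination E f x = ∑ i, f i x • E i x := rfl

/-- An orthonormal frame whose brackets have constant coefficients. -/
structure IsOrthonormalFrame (g : SmoothMetric n M) (E : Fin n → SmoothVF n M)
    (k : Fin n → Fin n → Fin n → ℝ) : Prop where
  inner_eq : ∀ x i j, g.inner x (E i x) (E j x) = if i = j then 1 else 0
  bracket_eq : ∀ i j x, mlieBracket (𝓡 n) (E i) (E j) x = ∑ l, k i j l • E l x

variable {g : SmoothMetric n M} {E : Fin n → SmoothVF n M} {k : Fin n → Fin n → Fin n → ℝ}

theorem inner_sum_left (x : M) (v : Fin n → TangentSpace (𝓡 n) x) (w : TangentSpace (𝓡 n) x) :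
    g.inner x (∑ i, v i) w = ∑ i, g.inner x (v i) w := by
  rw [map_sum, sum_apply]

theorem IsOrthonormalFrame.inner_sum_smul (hE : IsOrthonormalFrame g E k) (x : M) (c : Fin n → ℝ)
    (j : Fin n) : g.inner x (∑ i, c i • E i x) (E j x) = c j := by
  rw [inner_sum_left]
  simp [hE.inner_eq]

theorem IsOrthonormalFrame.linearIndependent (hE : IsOrthonormalFrame g E k) (x : M) :
    LinearIndependent ℝ fun i => E i x := by
  rw [Fintype.linearIndependent_iff]
  intro c hc i
  rw [← hE.inner_sum_smul x c i, hc]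
  simp

theorem IsOrthonormalFrame.eq_sum (hE : IsOrthonormalFrame g E k) (x : M)
    (v : TangentSpace (𝓡 n) x) : v = ∑ i, g.inner x v (E i x) • E i x := by
  have hfin : finrank ℝ (TangentSpace (𝓡 n) x) = n := finrank_euclideanSpace_fin
  have : FiniteDimensional ℝ (TangentSpace (𝓡 n) x) :=
    inferInstanceAs (FiniteDimensional ℝ (EuclideanSpace ℝ (Fin n)))
  let b := basisOfLinearIndependentOfCardEqFinrank' (fun i => E i x) (hE.linearIndependent x)
    (by rw [hfin, Fintype.card_fin])
  have hb : ∀ i, b i = E i x := fun i => by simp [b]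
  have h1 : ∑ i, b.repr v i • E i x = v := by
    simpa only [hb] using b.sum_repr v
  have h2 : ∀ i, g.inner x v (E i x) = b.repr v i := fun i => by
    conv_lhs => rw [← h1]
    exact hE.inner_sum_smul x _ i
  simp only [h2, h1]

theorem IsOrthonormalFrame.combination_pairingFun (hE : IsOrthonormalFrame g E k)
    (X : SmoothVF n M) : combination E (fun i => pairingFun g X (E i)) = X := by
  ext1 x
  exact (hE.eq_sum x (X x)).symm

theorem IsOrthonormalFrame.pairingFun_combination (hE : IsOrthonormalFrame g E k)
    (f : Fin n → SmoothFun n M) (i : Fin n) : pairingFun g (combination E f) (E i) = f i := by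
  ext x
  exact hE.inner_sum_smul x _ i

theorem inner_combination (x : M)
    (v : TangentSpace (𝓡 n) x) (f : Fin n → SmoothFun n M) :
    g.inner x v (combination E f x) = ∑ i, g.inner x v (E i x) * f i x := by
  rw [combination_apply, map_sum]
  exact Finset.sum_congr rfl fun i _ => by rw [map_smul, smul_eq_mul, mul_comm]

theorem toDerivation_combination (f : Fin n → SmoothFun n M) (h : SmoothFun n M) (x : M) :
    (combination E f).toDerivation h x = ∑ i, f i x * (E i).toDerivation h x := by
  rw [toDerivation_apply, combination_apply, map_sum]
  exact Finset.sum_congr rfl fun i _ => by rw [map_smul, smul_eq_mul, toDerivation_apply]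

theorem mlieBracket_combination_right (X : SmoothVF n M) (f : Fin n → SmoothFun n M) (x : M) :
    mlieBracket (𝓡 n) X (combination E f) x
      = ∑ i, (X.toDerivation (f i) x • E i x + f i x • mlieBracket (𝓡 n) X (E i) x) := by
  have key : ∀ s : Finset (Fin n), mlieBracket (𝓡 n) X (fun y => ∑ i ∈ s, f i y • E i y) x
      = ∑ i ∈ s, (X.toDerivation (f i) x • E i x + f i x • mlieBracket (𝓡 n) X (E i) x) := by
    intro s
    induction s using Finset.induction_on with
    | empty => exact congrFun mlieBracket_zero_right x
    | insert i s hi ih =>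
      have hs : MDifferentiableAt (𝓡 n) (𝓡 n).tangent
          (fun y => (⟨y, ∑ i ∈ s, f i y • E i y⟩ : TangentBundle (𝓡 n) M)) x :=
        (ContMDiff.sum_section (n := ∞) fun i _ => ContMDiff.smul_section (f i).contMDiff
          (E i).contMDiff).mdifferentiableAt (by simp)
      have h1 : (fun y => ∑ j ∈ insert i s, f j y • E j y)
          = (⇑(f i) • ⇑(E i)) + fun y => ∑ j ∈ s, f j y • E j y := by
        funext y
        rw [Finset.sum_insert hi]
        rfl
      have h2 : MDifferentiableAt (𝓡 n) (𝓡 n).tangent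
          (fun y => (⟨y, (⇑(f i) • ⇑(E i)) y⟩ : TangentBundle (𝓡 n) M)) x :=
        (ContMDiff.smul_section (f i).contMDiff (E i).contMDiff).mdifferentiableAt
          (n := ∞) (by simp)
      rw [h1, mlieBracket_add_right h2 hs, ih, Finset.sum_insert hi,
        mlieBracket_smul_right ((f i).mdifferentiableAt x) ((E i).mdifferentiableAt x)]
      rfl
  exact key Finset.univ

theorem IsOrthonormalFrame.inner_mlieBracket_right (hE : IsOrthonormalFrame g E k)
    (X : SmoothVF n M) (f : Fin n → SmoothFun n M) (x : M) (l : Fin n) :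
    g.inner x (mlieBracket (𝓡 n) X (combination E f) x) (E l x)
      = X.toDerivation (f l) x
        + ∑ j, f j x * g.inner x (mlieBracket (𝓡 n) X (E j) x) (E l x) := by
  rw [mlieBracket_combination_right, inner_sum_left]
  simp [hE.inner_eq, Finset.sum_add_distrib]

theorem IsOrthonormalFrame.inner_mlieBracket_frame (hE : IsOrthonormalFrame g E k)
    (f : Fin n → SmoothFun n M) (x : M) (i l : Fin n) :
    g.inner x (mlieBracket (𝓡 n) (combination E f) (E i) x) (E l x)
      = - (E i).toDerivation (f l) x + ∑ j, f j x * k j i l := by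
  rw [mlieBracket_swap_apply, map_neg, neg_apply, hE.inner_mlieBracket_right]
  have : ∀ j, g.inner x (mlieBracket (𝓡 n) (E i) (E j) x) (E l x) = - k j i l := by
    intro j
    rw [mlieBracket_swap_apply, map_neg, neg_apply, hE.bracket_eq, hE.inner_sum_smul]
  simp only [this]
  simp [Finset.sum_neg_distrib]
  ring

theorem IsOrthonormalFrame.inner_mlieBracket (hE : IsOrthonormalFrame g E k)
    (f h : Fin n → SmoothFun n M) (x : M) (l : Fin n) :
    g.inner x (mlieBracket (𝓡 n) (combination E f) (combination E h) x) (E l x)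
      = (combination E f).toDerivation (h l) x - (combination E h).toDerivation (f l) x
        + ∑ j, ∑ i, h j x * f i x * k i j l := by
  rw [hE.inner_mlieBracket_right]
  simp only [hE.inner_mlieBracket_frame]
  rw [toDerivation_combination h, sub_add_eq_add_sub, add_sub_assoc, ← Finset.sum_sub_distrib]
  congr 1
  refine Finset.sum_congr rfl fun j _ => ?_
  rw [mul_add, Finset.mul_sum]
  simp only [mul_assoc]
  ring

/-- The Lie bracket of smooth vector fields, as a smooth vector field. -/
noncomputable def bracketField (U V : SmoothVF n M) : SmoothVF n M :=
  ⟨mlieBracket (𝓡 n) U V, by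
    have : IsManifold (𝓡 n) ((((⊤ : ℕ∞) : WithTop ℕ∞)) + 1) M :=
      inferInstanceAs (IsManifold (𝓡 n) ∞ M)
    have : IsManifold (𝓡 n) (minSmoothness ℝ 2) M := isManifold_minSmoothness_of_infty (m := 2)
    have : IsManifold (𝓡 n) (minSmoothness ℝ 3) M := isManifold_minSmoothness_of_infty (m := 3)
    exact ContDiff.mlieBracket_vectorField (m := ⊤) (n := ⊤) U.contMDiff V.contMDiff (by
      rw [minSmoothness_of_isRCLikeNormedField]; rfl)⟩

/-- The product of a smooth function and a smooth vector field. -/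
noncomputable def smulField (f : SmoothFun n M) (V : SmoothVF n M) : SmoothVF n M :=
  ⟨⇑f • ⇑V, ContMDiff.smul_section f.contMDiff V.contMDiff⟩

theorem bracketField_smulField (U V : SmoothVF n M) (f : SmoothFun n M) :
    bracketField U (smulField f V)
      = smulField (U.toDerivation f) V + smulField f (bracketField U V) := by
  ext1 x
  exact mlieBracket_smul_right (V := ⇑U) (f.mdifferentiableAt x) (V.mdifferentiableAt x)

theorem bracketField_add (U V W : SmoothVF n M) :
    bracketField U (V + W) = bracketField U V + bracketField U W := by
  ext1 x
  exact mlieBracket_add_right (V.mdifferentiableAt x) (W.mdifferentiableAt x)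

theorem bracketField_jacobi (U V W : SmoothVF n M) :
    bracketField U (bracketField V W)
      = bracketField (bracketField U V) W + bracketField V (bracketField U W) := by
  have : IsManifold (𝓡 n) (minSmoothness ℝ 3) M := isManifold_minSmoothness_of_infty (m := 3)
  have : IsManifold (𝓡 n) (minSmoothness ℝ 2) M := isManifold_minSmoothness_of_infty (m := 2)
  have h : minSmoothness ℝ 2 ≤ ∞ := by
    rw [minSmoothness_of_isRCLikeNormedField]; exact WithTop.coe_le_coe.2 le_top
  ext1 x
  exact leibniz_identity_mlieBracket_apply (U.contMDiff.of_le h).contMDiffAt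
    (V.contMDiff.of_le h).contMDiffAt (W.contMDiff.of_le h).contMDiffAt

/-- Expand the Jacobi identity for U, V, fW by the Leibniz rule: the terms with first derivatives of
f cancel, those with f itself cancel by the Jacobi identity for U, V, W, and the coefficient of W is
left. -/
theorem toDerivation_bracketField (U V W : SmoothVF n M) (f : SmoothFun n M) :
    smulField (U.toDerivation (V.toDerivation f)) W
      = smulField (V.toDerivation (U.toDerivation f)) W
        + smulField ((bracketField U V).toDerivation f) W := by
  have h := bracketField_jacobi U V (smulField f W)
  simp only [bracketField_smulField, bracketField_add, bracketField_jacobi U V W] at h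
  have h' : ∀ A B : SmoothVF n M, smulField f (A + B) = smulField f A + smulField f B := by
    intro A B
    ext1 x
    exact smul_add (f x) (A x) (B x)
  rw [h'] at h
  rw [← sub_eq_zero] at h ⊢
  rw [← h]
  abel

theorem IsOrthonormalFrame.toDerivation_commutator (hE : IsOrthonormalFrame g E k)
    (i j : Fin n) (f : SmoothFun n M) :
    (E i).toDerivation ((E j).toDerivation f) - (E j).toDerivation ((E i).toDerivation f)
      = ∑ l, k i j l • (E l).toDerivation f := by
  -- Pairing with the unit field E i recovers h from h • E i, so the factor W = E i can be removed
  -- from `toDerivation_bracketField`.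
  have h1 : ∀ h : SmoothFun n M, pairingFun g (smulField h (E i)) (E i) = h := by
    intro h
    ext x
    change g.inner x (h x • E i x) (E i x) = h x
    simp [hE.inner_eq]
  have h2 : (bracketField (E i) (E j)).toDerivation f = ∑ l, k i j l • (E l).toDerivation f := by
    ext x
    rw [toDerivation_apply, SmoothFun.sum_apply]
    change mvfderiv (𝓡 n) f x (mlieBracket (𝓡 n) (E i) (E j) x) = _
    rw [hE.bracket_eq, map_sum]
    exact Finset.sum_congr rfl fun l _ => map_smul _ _ _
  have h3 := toDerivation_bracketField (E i) (E j) (E i) f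
  have h4 : ∀ A B C : SmoothFun n M,
      smulField A (E i) = smulField B (E i) + smulField C (E i) → A = B + C := by
    intro A B C h
    have : smulField A (E i) = smulField (B + C) (E i) := by
      rw [h]
      ext1 x
      exact (add_smul (B x) (C x) (E i x)).symm
    rw [← h1 A, this, h1]
  rw [h4 _ _ _ h3, h2, add_sub_cancel_left]

theorem IsOrthonormalFrame.pairing_combination (hE : IsOrthonormalFrame g E k)
    (f h : Fin n → SmoothFun n M) :
    pairingFun g (combination E f) (combination E h) = ∑ i, f i * h i := by
  ext x
  rw [pairingFun_apply, inner_combination, SmoothFun.sum_apply]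
  refine Finset.sum_congr rfl fun i _ => ?_
  rw [← pairingFun_apply, hE.pairingFun_combination]
  rfl

/-- The Killing equation in an orthonormal frame with constant structure coefficients. -/
theorem IsOrthonormalFrame.isKilling_combination_iff (hE : IsOrthonormalFrame g E k)
    (f : Fin n → SmoothFun n M) :
    IsKilling g (combination E f) ↔ ∀ i j x,
      (E i).toDerivation (f j) x + (E j).toDerivation (f i) x
        = ∑ l, f l x * (k l i j + k l j i) := by
  set X := combination E f with hX
  have hB : ∀ x i j, g.inner x (mlieBracket (𝓡 n) X (E i) x) (E j x)
      = - (E i).toDerivation (f j) x + ∑ l, f l x * k l i j :=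
    fun x i j => hE.inner_mlieBracket_frame f x i j
  have hconst : ∀ i j x, mvfderiv (𝓡 n) (pairing g (E i) (E j)) x = 0 := by
    intro i j x
    have : pairing g (E i) (E j) = fun _ => if i = j then 1 else 0 :=
      funext fun x => hE.inner_eq x i j
    rw [this, mvfderiv_const]
  constructor
  · intro h i j x
    have h1 := h (E i) (E j) x
    rw [hconst, g.symm x (E i x), hB, hB] at h1
    simp only [mul_add, Finset.sum_add_distrib, zero_apply] at h1 ⊢
    linarith
  · intro h Y Z x
    -- On the frame, where g has constant coefficients, the Killing equation says that the matrix of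
    -- [X, ·] is skew. For general Y, Z the derivatives of the coefficients match by the Leibniz
    -- rule, and skewness cancels the rest.
    have hB' : ∀ i j, g.inner x (mlieBracket (𝓡 n) X (E i) x) (E j x)
        = - g.inner x (mlieBracket (𝓡 n) X (E j) x) (E i x) := by
      intro i j
      have h1 := h i j x
      simp only [mul_add, Finset.sum_add_distrib] at h1
      rw [hB, hB]
      linarith
    obtain ⟨y, rfl⟩ : ∃ y, combination E y = Y := ⟨_, hE.combination_pairingFun Y⟩
    obtain ⟨z, rfl⟩ : ∃ z, combination E z = Z := ⟨_, hE.combination_pairingFun Z⟩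
    have h1 : mvfderiv (𝓡 n) (pairing g (combination E y) (combination E z)) x (X x)
        = ∑ i, (X.toDerivation (y i) x * z i x + y i x * X.toDerivation (z i) x) := by
      change X.toDerivation (pairingFun g (combination E y) (combination E z)) x = _
      rw [hE.pairing_combination, map_sum, SmoothFun.sum_apply]
      refine Finset.sum_congr rfl fun i _ => ?_
      rw [Derivation.leibniz]
      change y i x * X.toDerivation (z i) x + z i x * X.toDerivation (y i) x = _
      ring
    rw [h1, g.symm x (combination E y x), inner_combination, inner_combination]
    simp only [hE.inner_mlieBracket_right, add_mul, Finset.sum_add_distrib, Finset.sum_mul]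
    have h2 : ∑ l, ∑ j, y j x * g.inner x (mlieBracket (𝓡 n) X (E j) x) (E l x) * z l x
        = - ∑ l, ∑ j, z j x * g.inner x (mlieBracket (𝓡 n) X (E j) x) (E l x) * y l x := by
      rw [Finset.sum_comm, ← Finset.sum_neg_distrib]
      refine Finset.sum_congr rfl fun l _ => ?_
      rw [← Finset.sum_neg_distrib]
      refine Finset.sum_congr rfl fun j _ => ?_
      rw [hB' l j]
      ring
    rw [h2]
    simp only [mul_comm (y _ x)]
    ring

/-- A Killing field is parallel at `p` iff the dual `1`-form is closed at `p`. -/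
theorem IsOrthonormalFrame.isParallelAt_combination_iff (hE : IsOrthonormalFrame g E k)
    (f : Fin n → SmoothFun n M) (hf : IsKilling g (combination E f)) (p : M) :
    IsParallelAt g (combination E f) p ↔ ∀ i j,
      (E i).toDerivation (f j) p - (E j).toDerivation (f i) p = ∑ l, k i j l * f l p := by
  set X := combination E f with hX
  -- Substituting the Killing equation for X(g(Y, Z)) turns the Koszul expression into the exterior
  -- derivative of the dual form of X at (Y, Z).
  have hk : ∀ Y Z : SmoothVF n M, koszul g Y X Z p = Y.toDerivation (pairingFun g Z X) p
      - Z.toDerivation (pairingFun g Y X) p - g.inner p (mlieBracket (𝓡 n) Y Z p) (X p) := by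
    intro Y Z
    have h1 := hf Y Z p
    rw [koszul, h1, mlieBracket_swap_apply (V := ⇑Y) (W := ⇑X), map_neg, neg_apply,
      g.symm p (Y p), pairing_comm g X Z]
    change Y.toDerivation (pairingFun g Z X) p + _ - Z.toDerivation (pairingFun g Y X) p + _ - _ - _
      = _
    ring
  have hXE : ∀ i, pairingFun g (E i) X = f i := by
    intro i
    rw [← hE.pairingFun_combination f i]
    ext x
    exact g.symm x _ _
  constructor
  · intro h i j
    have h1 := h (E i) (E j)
    rw [hk, hXE, hXE, hE.bracket_eq, inner_sum_left] at h1
    have h2 : ∑ l, g.inner p (k i j l • E l p) (X p) = ∑ l, k i j l * f l p := by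
      refine Finset.sum_congr rfl fun l _ => ?_
      rw [map_smul, smul_apply, smul_eq_mul, ← hXE l]
      rfl
    rw [h2] at h1
    linarith
  · intro h Y Z
    rw [hk]
    obtain ⟨y, rfl⟩ : ∃ y, combination E y = Y := ⟨_, hE.combination_pairingFun Y⟩
    obtain ⟨z, rfl⟩ : ∃ z, combination E z = Z := ⟨_, hE.combination_pairingFun Z⟩
    have hp : ∀ (W : SmoothVF n M) (u : Fin n → SmoothFun n M),
        W.toDerivation (pairingFun g (combination E u) X) p
        = ∑ i, (W.toDerivation (u i) p * f i p + u i p * W.toDerivation (f i) p) := by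
      intro W u
      rw [hE.pairing_combination, map_sum, SmoothFun.sum_apply]
      refine Finset.sum_congr rfl fun i _ => ?_
      rw [Derivation.leibniz]
      change u i p * W.toDerivation (f i) p + f i p * W.toDerivation (u i) p = _
      ring
    rw [hp, hp, inner_combination]
    simp only [hE.inner_mlieBracket, add_mul, sub_mul, Finset.sum_add_distrib,
      Finset.sum_sub_distrib]
    simp only [toDerivation_combination _ (f _), Finset.mul_sum, Finset.sum_mul]
    have h2 : ∑ j, ∑ i, z j p * (y i p * (E i).toDerivation (f j) p)
        - ∑ i, ∑ j, y i p * (z j p * (E j).toDerivation (f i) p)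
        = ∑ l, ∑ j, ∑ i, z j p * y i p * k i j l * f l p := by
      rw [Finset.sum_comm (s := Finset.univ) (t := Finset.univ)
        (f := fun l j => ∑ i, z j p * y i p * k i j l * f l p)]
      rw [Finset.sum_comm (f := fun i j => y i p * (z j p * (E j).toDerivation (f i) p)),
        ← Finset.sum_sub_distrib]
      refine Finset.sum_congr rfl fun j _ => ?_
      rw [Finset.sum_comm, ← Finset.sum_sub_distrib]
      refine Finset.sum_congr rfl fun i _ => ?_
      have h3 : z j p * (y i p * (E i).toDerivation (f j) p)
          - y i p * (z j p * (E j).toDerivation (f i) p)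
          = z j p * y i p * ((E i).toDerivation (f j) p - (E j).toDerivation (f i) p) := by ring
      rw [h3, h i j, Finset.mul_sum]
      exact Finset.sum_congr rfl fun l _ => by ring
    linarith

end Frame

/-! ### Left-invariant frames on the Lie group -/

section LeftInvariant

variable {G : Type*} [TopologicalSpace G] [ChartedSpace (EuclideanSpace ℝ (Fin 3)) G] [Group G]
  [LieGroup (𝓡 3) ∞ G]

/-- The field is the tangent map of multiplication applied to the smooth section (0 at x, v at 1)
over G × G. -/
theorem contMDiff_infty_mulInvariantVectorField (v : GroupLieAlgebra (𝓡 3) G) :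
    ContMDiff (𝓡 3) (𝓡 3).tangent ∞
      (fun x : G => (⟨x, mulInvariantVectorField v x⟩ : TangentBundle (𝓡 3) G)) := by
  have sfg : ContMDiff (𝓡 3) (𝓡 3).tangent ∞
      (fun x : G => (⟨x, 0⟩ : TangentBundle (𝓡 3) G)) := contMDiff_zeroSection _ _
  have sfv : ContMDiff (𝓡 3) (𝓡 3).tangent ∞
      (fun _ : G => (⟨1, v⟩ : TangentBundle (𝓡 3) G)) := contMDiff_const
  have S₂ : ContMDiff ((𝓡 3).tangent.prod (𝓡 3).tangent) ((𝓡 3).prod (𝓡 3)).tangent ∞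
    (equivTangentBundleProd (𝓡 3) G (𝓡 3) G).symm := contMDiff_equivTangentBundleProd_symm
  have S₃ : ContMDiff ((𝓡 3).prod (𝓡 3)).tangent (𝓡 3).tangent ∞
      (tangentMap ((𝓡 3).prod (𝓡 3)) (𝓡 3) (fun p : G × G => p.1 * p.2)) :=
    (contMDiff_mul (𝓡 3) ∞).contMDiff_tangentMap (by simp)
  have S := (S₃.comp S₂).comp (sfg.prodMk sfv)
  convert! S with x
  · simp
  · simp only [Function.comp_apply, tangentMap]
    rw [mfderiv_prod_eq_add_apply ((contMDiff_mul (𝓡 3) ∞).mdifferentiableAt (by simp))]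
    simp +instances [mulInvariantVectorField]
    exact ((congrArg (· + _) (map_zero _)).trans (zero_add _)).symm

/-- The left-invariant vector field with value `v` at the identity. -/
noncomputable def leftInvariantField (v : GroupLieAlgebra (𝓡 3) G) : SmoothVF 3 G :=
  ⟨mulInvariantVectorField v, contMDiff_infty_mulInvariantVectorField v⟩

theorem leftInvariantField_one (v : GroupLieAlgebra (𝓡 3) G) : leftInvariantField v (1 : G) = v := by
  change mfderiv (𝓡 3) (𝓡 3) (fun x : G => 1 * x) 1 v = v
  have h : (fun x : G => 1 * x) = id := funext one_mul
  rw [h, mfderiv_id]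
  rfl

/-- The structure constants of the Lie algebra with defining triple `(a, b, c)`. -/
def tripleConst (a b c : ℝ) : Fin 3 → Fin 3 → Fin 3 → ℝ :=
  ![![![0, 0, 0], ![0, a, b], ![0, c, a]], ![![0, -a, -b], ![0, 0, 0], ![0, 0, 0]],
    ![![0, -c, -a], ![0, 0, 0], ![0, 0, 0]]]

theorem DefinesTriple.bracket_eq {g : SmoothMetric 3 G} {e : Fin 3 → GroupLieAlgebra (𝓡 3) G}
    {a b c : ℝ} (he : DefinesTriple g e a b c) (i j : Fin 3) :
    ⁅e i, e j⁆ = ∑ l, tripleConst a b c i j l • e l := by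
  have hself : ∀ v : GroupLieAlgebra (𝓡 3) G, ⁅v, v⁆ = 0 := fun v => by
    rw [GroupLieAlgebra.bracket_def, mlieBracket_self]; rfl
  have hskew : ∀ v w : GroupLieAlgebra (𝓡 3) G, ⁅v, w⁆ = - ⁅w, v⁆ := fun v w => by
    rw [GroupLieAlgebra.bracket_def, mlieBracket_swap_apply]; rfl
  have h01 := he.bracket_01
  have h02 := he.bracket_02
  have h12 := he.bracket_12
  fin_cases i <;> fin_cases j <;>
    simp [Fin.sum_univ_three, tripleConst, hself, h01, h02, h12, hskew (e 1) (e 0),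
      hskew (e 2) (e 0), hskew (e 2) (e 1)] <;> abel

theorem DefinesTriple.isOrthonormalFrame {g : SmoothMetric 3 G} (hg : IsLeftInvariant g)
    {e : Fin 3 → GroupLieAlgebra (𝓡 3) G} {a b c : ℝ} (he : DefinesTriple g e a b c) :
    IsOrthonormalFrame g (fun i => leftInvariantField (e i)) (tripleConst a b c) where
  inner_eq x i j := by
    rw [← he.orthonormal i j, ← hg x 1 (e i) (e j)]
    -- Left translation lands in the tangent space at x * 1. Stating the transport on the model
    -- space, with which every tangent space is identified definitionally, avoids a cast to the one
    -- at x.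
    have key : ∀ (y : G), y = x → ∀ u v : EuclideanSpace ℝ (Fin 3),
        g.inner x u v = g.inner y u v := by
      rintro _ rfl u v
      rfl
    exact key (x * 1) (mul_one x) _ _
  bracket_eq i j x := by
    have : LieGroup (𝓡 3) (minSmoothness ℝ 3) G := LieGroup.of_le (n := ∞) (by
      rw [minSmoothness_of_isRCLikeNormedField]; exact WithTop.coe_le_coe.2 le_top)
    have h1 := congrFun (mulInvariantVector_mlieBracket (e i) (e j)) x
    rw [← GroupLieAlgebra.bracket_def, he.bracket_eq] at h1
    change mlieBracket (𝓡 3) (mulInvariantVectorField (e i)) (mulInvariantVectorField (e j)) x = _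
    rw [← h1]
    change mfderiv (𝓡 3) (𝓡 3) (fun y : G => x * y) 1 _ = _
    rw [map_sum]
    exact Finset.sum_congr rfl fun l _ => map_smul _ _ _

end LeftInvariant

/-! ### Prolongation of the Killing equation -/

section Prolongation

variable {F : Type*} [AddCommGroup F] [Module ℝ F]

/-- The first-order system satisfied by the components `p, q, r` of a Killing field and the
components `w₁, w₂, w₃` of its covariant derivative, in a frame with structure constants given by
the triple `(a, s + d, s - d)`. -/
structure KillingSystem (D₀ D₁ D₂ : F →ₗ[ℝ] F) (a s d : ℝ) (p q r w₁ w₂ w₃ : F) : Prop where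
  comm₀₁ : ∀ f, D₀ (D₁ f) - D₁ (D₀ f) = a • D₁ f + (s + d) • D₂ f
  comm₀₂ : ∀ f, D₀ (D₂ f) - D₂ (D₀ f) = (s - d) • D₁ f + a • D₂ f
  comm₁₂ : ∀ f, D₁ (D₂ f) - D₂ (D₁ f) = 0
  p₀ : D₀ p = 0
  p₁ : D₁ p = -(a • q) - s • r - w₃
  p₂ : D₂ p = -(s • q) - a • r - w₂
  q₀ : D₀ q = d • r + w₃
  q₁ : D₁ q = a • p
  q₂ : D₂ q = s • p - w₁
  r₀ : D₀ r = -(d • q) + w₂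
  r₁ : D₁ r = s • p + w₁
  r₂ : D₂ r = a • p

namespace KillingSystem

variable {D₀ D₁ D₂ : F →ₗ[ℝ] F} {a s d : ℝ} {p q r w₁ w₂ w₃ : F}
  (h : KillingSystem D₀ D₁ D₂ a s d p q r w₁ w₂ w₃)
include h

/-- The three commutators applied to p, q, r give nine relations; they determine the nine
derivatives of w₁, w₂, w₃ and so close the system. -/
theorem w₃₀ : D₀ w₃ = (a ^ 2 + s ^ 2 + 2 * s * d) • q + (2 * a * s) • r + d • w₂ := by
  have E := h.comm₀₁ p
  simp only [h.p₀, h.p₁, h.p₂, h.q₀, h.r₀, map_sub, map_neg, map_smul, map_zero] at E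
  linear_combination (norm := module) (-1 : ℝ) • E

theorem w₂₀ : D₀ w₂ = (2 * a * s) • q + (a ^ 2 + s ^ 2 - 2 * s * d) • r - d • w₃ := by
  have E := h.comm₀₂ p
  simp only [h.p₀, h.p₁, h.p₂, h.q₀, h.r₀, map_sub, map_neg, map_smul, map_zero] at E
  linear_combination (norm := module) (-1 : ℝ) • E

theorem w₃₁ : D₁ w₃ = -((a ^ 2 + s ^ 2 + 2 * s * d) • p) + s • w₁ := by
  have E := h.comm₀₁ q
  simp only [h.p₀, h.q₀, h.q₁, h.q₂, h.r₁, map_add, map_smul, smul_zero] at E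
  linear_combination (norm := module) (-1 : ℝ) • E

theorem w₂₁ : D₁ w₂ = -((2 * a * s) • p) - a • w₁ := by
  have E₁ := h.comm₁₂ p
  have E₂ := h.comm₀₂ q
  have E₃ := h.comm₀₁ r
  simp only [h.p₀, h.p₁, h.p₂, h.q₀, h.q₁, h.q₂, h.r₀, h.r₁, h.r₂, map_sub, map_add, map_neg,
    map_smul, smul_zero] at E₁ E₂ E₃
  -- D₀ w₁, D₁ w₂ and D₂ w₃ occur only in pairs in these three relations. A half-sum isolates one of
  -- them, as for Christoffel symbols.
  linear_combination (norm := module) (-1/2 : ℝ) • E₁ - (1/2 : ℝ) • E₂ - (1/2 : ℝ) • E₃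

theorem w₂₂ : D₂ w₂ = -((a ^ 2 + s ^ 2 - 2 * s * d) • p) - s • w₁ := by
  have E := h.comm₀₂ r
  simp only [h.p₀, h.q₂, h.r₀, h.r₁, h.r₂, map_add, map_neg, map_smul, smul_zero] at E
  linear_combination (norm := module) (-1 : ℝ) • E

theorem w₃₂ : D₂ w₃ = a • w₁ - (2 * a * s) • p := by
  have E₁ := h.comm₁₂ p
  have E₂ := h.w₂₁
  simp only [h.p₁, h.p₂, h.q₁, h.q₂, h.r₁, h.r₂, map_sub, map_neg, map_smul] at E₁
  linear_combination (norm := module) E₁ + E₂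

theorem w₁₀ : D₀ w₁ = 0 := by
  have E₁ := h.comm₀₁ r
  have E₂ := h.w₂₁
  simp only [h.p₀, h.q₁, h.r₀, h.r₁, h.r₂, map_add, map_neg, map_smul, smul_zero] at E₁
  linear_combination (norm := module) E₁ + E₂

theorem w₁₁ : D₁ w₁ = (a ^ 2 - s ^ 2) • r + a • w₂ - s • w₃ := by
  have E := h.comm₁₂ q
  simp only [h.p₁, h.p₂, h.q₁, h.q₂, map_sub, map_smul] at E
  linear_combination (norm := module) (-1 : ℝ) • E

theorem w₁₂ : D₂ w₁ = (s ^ 2 - a ^ 2) • q + s • w₂ - a • w₃ := by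
  have E := h.comm₁₂ r
  simp only [h.p₁, h.p₂, h.r₁, h.r₂, map_add, map_smul] at E
  linear_combination (norm := module) (-1 : ℝ) • E

/-- The integrability conditions of the equations for the wᵢ: geometrically, consequences of the
flow of X preserving the curvature. They are void for s = 0, where the curvature is constant. -/
theorem constraint₁ : s • ((a ^ 2 - s ^ 2 - d * s) • q - (a * d) • r - (s + d) • w₂ + a • w₃) = 0 := by
  have E := h.comm₀₁ w₁
  simp only [h.w₁₀, h.w₁₁, h.w₁₂, h.w₂₀, h.w₃₀, h.r₀, map_sub, map_add, map_smul, map_zero] at E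
  linear_combination (norm := module) (1/2 : ℝ) • E

theorem constraint₂ : s • ((a * d) • q + (a ^ 2 - s ^ 2 + s * d) • r + a • w₂ - (s - d) • w₃) = 0 := by
  have E := h.comm₀₂ w₁
  simp only [h.w₁₀, h.w₁₁, h.w₁₂, h.w₂₀, h.w₃₀, h.q₀, map_sub, map_add, map_smul, map_zero] at E
  linear_combination (norm := module) (-1/2 : ℝ) • E

theorem constraint₃ : (s * d) • (d • p - w₁) = 0 := by
  have E := h.comm₀₂ w₃
  simp only [h.w₁₀, h.w₂₂, h.w₃₀, h.w₃₁, h.w₃₂, h.p₀, h.q₂, h.r₂, map_add, map_sub,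
    map_smul, smul_zero] at E
  linear_combination (norm := module) (-1/4 : ℝ) • E

end KillingSystem

/-- The constraints on the value of a Killing field whose covariant derivative vanishes. -/
theorem KillingSystem.eval_eq_zero {D₀ D₁ D₂ : F →ₗ[ℝ] F} {a s d : ℝ} {p q r w₁ w₂ w₃ : F}
    (h : KillingSystem D₀ D₁ D₂ a s d p q r w₁ w₂ w₃) (hs : s ≠ 0) (ev : F →ₗ[ℝ] ℝ)
    (h₁ : ev w₁ = 0) (h₂ : ev w₂ = 0) (h₃ : ev w₃ = 0) :
    d * ev p = 0 ∧
    (a ^ 2 - s ^ 2 - d * s) * ev q - a * d * ev r = 0 ∧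
    a * d * ev q + (a ^ 2 - s ^ 2 + s * d) * ev r = 0 ∧
    (a ^ 2 - s ^ 2 + d ^ 2) * (a * ev q + s * ev r) = 0 ∧
    (a ^ 2 - s ^ 2 + d ^ 2) * (s * ev q + a * ev r) = 0 := by
  have K₁ := (smul_eq_zero.1 h.constraint₁).resolve_left hs
  have K₂ := (smul_eq_zero.1 h.constraint₂).resolve_left hs
  have e₁ := congrArg ev K₁
  have e₂ := congrArg ev K₂
  have e₃ := congrArg ev h.constraint₃
  -- The constraints hold identically, so they may be differentiated before evaluation. D₀ turns w₂,
  -- w₃ back into combinations of q, r, which gives the two conditions with factor a² - s² + d² = a²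
  -- - bc.
  have L₁ := congrArg (fun f => ev (D₀ f)) K₁
  have L₂ := congrArg (fun f => ev (D₀ f)) K₂
  simp only [h.w₂₀, h.w₃₀, h.q₀, h.r₀, map_sub, map_add, map_neg, map_smul, map_zero,
    h₁, h₂, h₃, smul_eq_mul] at e₁ e₂ e₃ L₁ L₂
  refine ⟨?_, by linear_combination e₁, by linear_combination e₂, ?_, ?_⟩
  · rcases eq_or_ne d 0 with rfl | hd
    · simp
    · have : s * d * (d * ev p) = 0 := by linear_combination e₃
      exact (mul_eq_zero.1 this).resolve_left (mul_ne_zero hs hd)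
  · linear_combination L₁
  · linear_combination L₂

end Prolongation

/-! ### Constraints on the symmetry subspace for a triple -/

section TripleFrame

variable {M : Type*} [TopologicalSpace M] [ChartedSpace (EuclideanSpace ℝ (Fin 3)) M]
  [IsManifold (𝓡 3) ∞ M] {g : SmoothMetric 3 M} {E : Fin 3 → SmoothVF 3 M} {a b c : ℝ}

theorem isKilling_triple_iff (hE : IsOrthonormalFrame g E (tripleConst a b c))
    (p q r : SmoothFun 3 M) :
    IsKilling g (combination E ![p, q, r]) ↔ ∀ x,
      (E 0).toDerivation p x = 0 ∧
      (E 0).toDerivation q x + (E 1).toDerivation p x = -(a * q x) - c * r x ∧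
      (E 0).toDerivation r x + (E 2).toDerivation p x = -(b * q x) - a * r x ∧
      (E 1).toDerivation q x = a * p x ∧
      (E 1).toDerivation r x + (E 2).toDerivation q x = (b + c) * p x ∧
      (E 2).toDerivation r x = a * p x := by
  rw [hE.isKilling_combination_iff]
  constructor
  · intro h x
    have h00 := h 0 0 x
    have h01 := h 0 1 x
    have h02 := h 0 2 x
    have h11 := h 1 1 x
    have h12 := h 1 2 x
    have h22 := h 2 2 x
    simp [Fin.sum_univ_three, tripleConst] at h00 h01 h02 h11 h12 h22
    refine ⟨?_, ?_, ?_, ?_, ?_, ?_⟩ <;> linarith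
  · intro h i j x
    obtain ⟨h1, h2, h3, h4, h5, h6⟩ := h x
    fin_cases i <;> fin_cases j <;> simp [Fin.sum_univ_three, tripleConst] <;> linarith

theorem isParallelAt_triple_iff (hE : IsOrthonormalFrame g E (tripleConst a b c))
    (p q r : SmoothFun 3 M) (hK : IsKilling g (combination E ![p, q, r])) (x : M) :
    IsParallelAt g (combination E ![p, q, r]) x ↔
      (E 0).toDerivation q x - (E 1).toDerivation p x = a * q x + b * r x ∧
      (E 0).toDerivation r x - (E 2).toDerivation p x = c * q x + a * r x ∧
      (E 1).toDerivation r x = (E 2).toDerivation q x := by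
  rw [hE.isParallelAt_combination_iff _ hK]
  constructor
  · intro h
    have h01 := h 0 1
    have h02 := h 0 2
    have h12 := h 1 2
    simp [Fin.sum_univ_three, tripleConst] at h01 h02 h12
    refine ⟨?_, ?_, ?_⟩ <;> linarith
  · rintro ⟨h1, h2, h3⟩ i j
    fin_cases i <;> fin_cases j <;> simp [Fin.sum_univ_three, tripleConst] <;> linarith

theorem mem_symmetrySubspace_of_killing (hE : IsOrthonormalFrame g E (tripleConst a b c))
    {p q r : SmoothFun 3 M} {x₀ : M} {v : TangentSpace (𝓡 3) x₀}
    (hv : p x₀ • E 0 x₀ + q x₀ • E 1 x₀ + r x₀ • E 2 x₀ = v)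
    (hK : ∀ x,
      (E 0).toDerivation p x = 0 ∧
      (E 0).toDerivation q x + (E 1).toDerivation p x = -(a * q x) - c * r x ∧
      (E 0).toDerivation r x + (E 2).toDerivation p x = -(b * q x) - a * r x ∧
      (E 1).toDerivation q x = a * p x ∧
      (E 1).toDerivation r x + (E 2).toDerivation q x = (b + c) * p x ∧
      (E 2).toDerivation r x = a * p x)
    (hP : (E 0).toDerivation q x₀ - (E 1).toDerivation p x₀ = a * q x₀ + b * r x₀ ∧
      (E 0).toDerivation r x₀ - (E 2).toDerivation p x₀ = c * q x₀ + a * r x₀ ∧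
      (E 1).toDerivation r x₀ = (E 2).toDerivation q x₀) :
    v ∈ symmetrySubspace g x₀ := by
  have hK' := (isKilling_triple_iff hE p q r).2 hK
  refine ⟨combination E ![p, q, r], hK', (isParallelAt_triple_iff hE p q r hK' x₀).2 hP, ?_⟩
  rw [← hv, combination_apply, Fin.sum_univ_three]
  rfl

/-- The value at `x₀` as a linear map on smooth functions. -/
noncomputable def evalLinear (x₀ : M) : SmoothFun 3 M →ₗ[ℝ] ℝ where
  toFun f := f x₀
  map_add' _ _ := rfl
  map_smul' _ _ := rfl

theorem symmetrySubspace_constraints (hE : IsOrthonormalFrame g E (tripleConst a b c)) {x₀ : M}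
    (hbc : b + c ≠ 0) {v : TangentSpace (𝓡 3) x₀} (hv : v ∈ symmetrySubspace g x₀) :
    ∃ P Q R : ℝ, v = P • E 0 x₀ + Q • E 1 x₀ + R • E 2 x₀ ∧ (b - c) * P = 0 ∧
      (2 * a ^ 2 - b * (b + c)) * Q = a * (b - c) * R ∧
      (2 * a ^ 2 - c * (b + c)) * R = - (a * (b - c) * Q) ∧
      (a ^ 2 - b * c) * (2 * a * Q + (b + c) * R) = 0 ∧
      (a ^ 2 - b * c) * ((b + c) * Q + 2 * a * R) = 0 := by
  obtain ⟨X, hX, hXp, rfl⟩ := hv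
  obtain ⟨p, q, r, rfl⟩ : ∃ p q r, combination E ![p, q, r] = X := by
    refine ⟨pairingFun g X (E 0), pairingFun g X (E 1), pairingFun g X (E 2), ?_⟩
    conv_rhs => rw [← hE.combination_pairingFun X]
    congr 1
    funext i
    fin_cases i <;> rfl
  have hP := (isParallelAt_triple_iff hE p q r hX x₀).1 hXp
  have hK := (isKilling_triple_iff hE p q r).1 hX
  set s := (b + c) / 2 with hs
  set d := (b - c) / 2 with hd
  have hcomm : ∀ i j f x, (E i).toDerivation ((E j).toDerivation f) x
      - (E j).toDerivation ((E i).toDerivation f) x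
      = tripleConst a b c i j 0 * (E 0).toDerivation f x
        + tripleConst a b c i j 1 * (E 1).toDerivation f x
        + tripleConst a b c i j 2 * (E 2).toDerivation f x := by
    intro i j f x
    have h := congrArg (fun f : SmoothFun 3 M => f x) (hE.toDerivation_commutator i j f)
    rw [Fin.sum_univ_three] at h
    exact h
  -- The wᵢ are defined so that the equations `q₀`, `r₀`, `r₁` become tautologies; the remaining
  -- first-order equations are then the six Killing equations.
  have hsys : KillingSystem (E 0).toDerivation.toLinearMap (E 1).toDerivation.toLinearMap
      (E 2).toDerivation.toLinearMap a s d p q r ((E 1).toDerivation r - s • p)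
      ((E 0).toDerivation r + d • q) ((E 0).toDerivation q - d • r) := by
    constructor
    case comm₀₁ =>
      intro f
      ext x
      have h := hcomm 0 1 f x
      simp [tripleConst] at h
      change (E 0).toDerivation ((E 1).toDerivation f) x
        - (E 1).toDerivation ((E 0).toDerivation f) x
        = a * (E 1).toDerivation f x + (s + d) * (E 2).toDerivation f x
      rw [h]; ring
    case comm₀₂ =>
      intro f
      ext x
      have h := hcomm 0 2 f x
      simp [tripleConst] at h
      change (E 0).toDerivation ((E 2).toDerivation f) x
        - (E 2).toDerivation ((E 0).toDerivation f) x
        = (s - d) * (E 1).toDerivation f x + a * (E 2).toDerivation f x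
      rw [h]; ring
    case comm₁₂ =>
      intro f
      ext x
      have h := hcomm 1 2 f x
      simp [tripleConst] at h
      exact h
    case p₀ => ext x; exact (hK x).1
    case p₁ =>
      ext x
      change (E 1).toDerivation p x
        = -(a * q x) - s * r x - ((E 0).toDerivation q x - d * r x)
      linear_combination (hK x).2.1
    case p₂ =>
      ext x
      change (E 2).toDerivation p x
        = -(s * q x) - a * r x - ((E 0).toDerivation r x + d * q x)
      linear_combination (hK x).2.2.1
    case q₀ =>
      ext x
      change (E 0).toDerivation q x = d * r x + ((E 0).toDerivation q x - d * r x)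
      ring
    case q₁ => ext x; exact (hK x).2.2.2.1
    case q₂ =>
      ext x
      change (E 2).toDerivation q x = s * p x - ((E 1).toDerivation r x - s * p x)
      linear_combination (hK x).2.2.2.2.1
    case r₀ =>
      ext x
      change (E 0).toDerivation r x = -(d * q x) + ((E 0).toDerivation r x + d * q x)
      ring
    case r₁ =>
      ext x
      change (E 1).toDerivation r x = s * p x + ((E 1).toDerivation r x - s * p x)
      ring
    case r₂ => ext x; exact (hK x).2.2.2.2.2
  obtain ⟨k1, k2, k3, k4, k5, k6⟩ := hK x₀
  obtain ⟨l1, l2, l3⟩ := hP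
  obtain ⟨e1, e2, e3, e4, e5⟩ := hsys.eval_eq_zero (by rw [hs]; positivity) (evalLinear x₀)
    -- At x₀ the Killing and closedness equations give the sum and the difference of the same two
    -- derivatives; their half-sum is the vanishing of each wᵢ.
    (by
      change (E 1).toDerivation r x₀ - s * p x₀ = 0
      linear_combination (1 / 2) * k5 + (1 / 2) * l3)
    (by
      change (E 0).toDerivation r x₀ + d * q x₀ = 0
      linear_combination (1 / 2) * k3 + (1 / 2) * l2)
    (by
      change (E 0).toDerivation q x₀ - d * r x₀ = 0
      linear_combination (1 / 2) * k2 + (1 / 2) * l1)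
  change d * p x₀ = 0 at e1
  change (a ^ 2 - s ^ 2 - d * s) * q x₀ - a * d * r x₀ = 0 at e2
  change a * d * q x₀ + (a ^ 2 - s ^ 2 + s * d) * r x₀ = 0 at e3
  change (a ^ 2 - s ^ 2 + d ^ 2) * (a * q x₀ + s * r x₀) = 0 at e4
  change (a ^ 2 - s ^ 2 + d ^ 2) * (s * q x₀ + a * r x₀) = 0 at e5
  refine ⟨p x₀, q x₀, r x₀, ?_, ?_, ?_, ?_, ?_, ?_⟩
  · rw [combination_apply, Fin.sum_univ_three]
    rfl
  · linear_combination 2 * e1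
  · linear_combination 2 * e2
  · linear_combination 2 * e3
  · linear_combination 2 * e4
  · linear_combination 2 * e5

end TripleFrame

/-! ### Linear systems, the time function and the dual coordinates -/

/-- Linear systems of ordinary differential equations with constant coefficients have global
smooth solutions. -/
theorem exists_linear_ode_solution {m : ℕ} (B : Matrix (Fin m) (Fin m) ℝ) (v : Fin m → ℝ) :
    ∃ f : Fin m → ℝ → ℝ, (∀ i, ContDiff ℝ ∞ (f i)) ∧ (∀ i, f i 0 = v i) ∧
      ∀ i t, HasDerivAt (f i) (∑ j, B i j * f j t) t := by
  let A : (Fin m → ℝ) →L[ℝ] (Fin m → ℝ) := LinearMap.toContinuousLinearMap (Matrix.toLin' B)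
  let F : ℝ → Fin m → ℝ := fun t => NormedSpace.exp (t • A) v
  have hF : ∀ t, HasDerivAt F (A (F t)) t := fun t =>
    ((hasDerivAt_exp_smul_const' (𝕂 := ℝ) A t).clm_apply (hasDerivAt_const t v)).congr_deriv (by simp [F])
  -- Bootstrapping: F' = A F has the regularity of F.
  have hsm : ∀ k : ℕ, ContDiff ℝ k F := by
    intro k
    induction k with
    | zero => exact contDiff_zero.2 (continuous_iff_continuousAt.2 fun t => (hF t).continuousAt)
    | succ k ih =>
      refine (contDiff_succ_iff_deriv (n := k)).2 ⟨fun t => (hF t).differentiableAt, by simp, ?_⟩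
      have : deriv F = fun t => A (F t) := funext fun t => (hF t).deriv
      rw [this]
      exact A.contDiff.comp ih
  refine ⟨fun i t => F t i, fun i => ?_, fun i => by simp [F], fun i t => ?_⟩
  · exact (contDiff_pi.1 (contDiff_infty.2 hsm)) i
  · have h := (hasDerivAt_pi.1 (hF t)) i
    convert! h using 1

section Functions

variable {M : Type*} [TopologicalSpace M] [ChartedSpace (EuclideanSpace ℝ (Fin 3)) M]
  [IsManifold (𝓡 3) ∞ M] {g : SmoothMetric 3 M} {E : Fin 3 → SmoothVF 3 M} {a b c : ℝ}

theorem eq_of_toDerivation_eq_zero {n : ℕ} {M : Type*} [TopologicalSpace M]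
    [ChartedSpace (EuclideanSpace ℝ (Fin n)) M] [IsManifold (𝓡 n) ∞ M] [PreconnectedSpace M]
    {g : SmoothMetric n M} {E : Fin n → SmoothVF n M} {k : Fin n → Fin n → Fin n → ℝ}
    (hE : IsOrthonormalFrame g E k) (f : SmoothFun n M)
    (h : ∀ i x, (E i).toDerivation f x = 0) (x y : M) : f x = f y := by
  have : IsLocallyConstant f := by
    rw [IsLocallyConstant.iff_eventually_eq]
    intro x
    exact eventually_eq_of_mfderiv_frame_eq_zero E hE.linearIndependent isOpen_univ (mem_univ x)
      (fun y _ => f.mdifferentiableAt y) fun y _ i => h i y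
  exact this.apply_eq_of_preconnectedSpace x y

theorem exists_smoothFun_primitive [SimplyConnectedSpace M]
    (hE : IsOrthonormalFrame g E (tripleConst a b c)) (x₀ : M) (f₀ f₁ f₂ : SmoothFun 3 M)
    (h₀₁ : ∀ x, (E 0).toDerivation f₁ x - (E 1).toDerivation f₀ x = a * f₁ x + b * f₂ x)
    (h₀₂ : ∀ x, (E 0).toDerivation f₂ x - (E 2).toDerivation f₀ x = c * f₁ x + a * f₂ x)
    (h₁₂ : ∀ x, (E 1).toDerivation f₂ x - (E 2).toDerivation f₁ x = 0) :
    ∃ F : SmoothFun 3 M, F x₀ = 0 ∧ (E 0).toDerivation F = f₀ ∧ (E 1).toDerivation F = f₁ ∧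
      (E 2).toDerivation F = f₂ := by
  let f : Fin 3 → SmoothFun 3 M := ![f₀, f₁, f₂]
  have hcl : ∀ i j x, (E i).toDerivation (f j) x - (E j).toDerivation (f i) x
      = ∑ l, tripleConst a b c i j l * f l x := by
    intro i j x
    have h1 := h₀₁ x
    have h2 := h₀₂ x
    have h3 := h₁₂ x
    fin_cases i <;> fin_cases j <;> simp [Fin.sum_univ_three, tripleConst, f] <;> linarith
  obtain ⟨F, hF, hF0, hFE⟩ := exists_primitive E hE.linearIndependent _ hE.bracket_eq
    (fun i => f i) (fun i => (f i).contMDiff) hcl x₀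
  refine ⟨⟨F, hF⟩, hF0, ?_, ?_, ?_⟩
  · ext x; exact hFE x 0
  · ext x; exact hFE x 1
  · ext x; exact hFE x 2

/-- A smooth function with `E₀ τ = 1`, `E₁ τ = E₂ τ = 0`. -/
structure IsTime (E : Fin 3 → SmoothVF 3 M) (x₀ : M) (τ : SmoothFun 3 M) : Prop where
  zero : τ x₀ = 0
  d₀ : (E 0).toDerivation τ = 1
  d₁ : (E 1).toDerivation τ = 0
  d₂ : (E 2).toDerivation τ = 0

theorem exists_isTime [SimplyConnectedSpace M]
    (hE : IsOrthonormalFrame g E (tripleConst a b c)) (x₀ : M) : ∃ τ, IsTime E x₀ τ := by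
  obtain ⟨τ, h, h0, h1, h2⟩ := exists_smoothFun_primitive hE x₀ 1 0 0
    (by intro x; simp) (by intro x; simp) (by intro x; simp)
  exact ⟨τ, h, h0, h1, h2⟩

/-- Solutions of linear systems in the time function. -/
theorem IsTime.exists_linear {x₀ : M} {τ : SmoothFun 3 M} (hτ : IsTime E x₀ τ) {m : ℕ}
    (B : Matrix (Fin m) (Fin m) ℝ) (v : Fin m → ℝ) :
    ∃ f : Fin m → SmoothFun 3 M, (∀ i, f i x₀ = v i) ∧
      (∀ i, (E 0).toDerivation (f i) = ∑ j, B i j • f j) ∧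
      (∀ i, (E 1).toDerivation (f i) = 0) ∧ ∀ i, (E 2).toDerivation (f i) = 0 := by
  obtain ⟨φ, hφ, hφ0, hφd⟩ := exists_linear_ode_solution B v
  let f : Fin m → SmoothFun 3 M := fun i => ⟨φ i ∘ τ, (hφ i).contMDiff.comp τ.contMDiff⟩
  have hd : ∀ (V : SmoothVF 3 M) i x, V.toDerivation (f i) x
      = (∑ j, B i j * f j x) * V.toDerivation τ x := by
    intro V i x
    have h1 := mvfderiv_comp_apply (g := φ i) (f := τ) x
      ((hφ i).contMDiff.mdifferentiableAt (by simp)) (τ.mdifferentiableAt x) (V x)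
    have h2 : mvfderiv 𝓘(ℝ) (φ i) (τ x) = ContinuousLinearMap.toSpanSingleton ℝ (∑ j, B i j * f j x) := by
      rw [mvfderiv, mfderiv_eq_fderiv]
      exact (hφd i (τ x)).hasFDerivAt.fderiv
    rw [h2] at h1
    rw [mul_comm]
    exact h1
  refine ⟨f, fun i => ?_, fun i => ?_, fun i => ?_, fun i => ?_⟩
  · change φ i (τ x₀) = v i
    rw [hτ.zero, hφ0]
  · ext x
    rw [hd, hτ.d₀, SmoothFun.sum_apply]
    exact mul_one _
  · ext x
    rw [hd, hτ.d₁]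
    exact mul_zero _
  · ext x
    rw [hd, hτ.d₂]
    exact mul_zero _

theorem IsTime.exists_linear₁ {x₀ : M} {τ : SmoothFun 3 M} (hτ : IsTime E x₀ τ) (α s : ℝ) :
    ∃ f : SmoothFun 3 M, f x₀ = s ∧ (E 0).toDerivation f = α • f ∧
      (E 1).toDerivation f = 0 ∧ (E 2).toDerivation f = 0 := by
  obtain ⟨f, h, h0, h1, h2⟩ := hτ.exists_linear !![α] ![s]
  exact ⟨f 0, h 0, by simpa using h0 0, h1 0, h2 0⟩

theorem IsTime.exists_linear₂ {x₀ : M} {τ : SmoothFun 3 M} (hτ : IsTime E x₀ τ)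
    (α β γ δ s t : ℝ) :
    ∃ f h : SmoothFun 3 M, f x₀ = s ∧ h x₀ = t ∧ (E 0).toDerivation f = α • f + β • h ∧
      (E 0).toDerivation h = γ • f + δ • h ∧ (E 1).toDerivation f = 0 ∧
      (E 1).toDerivation h = 0 ∧ (E 2).toDerivation f = 0 ∧ (E 2).toDerivation h = 0 := by
  obtain ⟨f, h, h0, h1, h2⟩ := hτ.exists_linear !![α, β; γ, δ] ![s, t]
  exact ⟨f 0, f 1, h 0, h 1, by simpa [Fin.sum_univ_two] using h0 0,
    by simpa [Fin.sum_univ_two] using h0 1, h1 0, h1 1, h2 0, h2 1⟩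

/-- Functions `z₁, z₂` which are dual to the fields `E 1, E 2`. -/
structure IsCoordinates (E : Fin 3 → SmoothVF 3 M) (a b c : ℝ) (x₀ : M) (z₁ z₂ : SmoothFun 3 M) :
    Prop where
  zero₁ : z₁ x₀ = 0
  zero₂ : z₂ x₀ = 0
  d₀₁ : (E 0).toDerivation z₁ = -(a • z₁) - c • z₂
  d₀₂ : (E 0).toDerivation z₂ = -(b • z₁) - a • z₂
  d₁₁ : (E 1).toDerivation z₁ = 1
  d₁₂ : (E 1).toDerivation z₂ = 0
  d₂₁ : (E 2).toDerivation z₁ = 0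
  d₂₂ : (E 2).toDerivation z₂ = 1

theorem IsTime.exists_isCoordinates [SimplyConnectedSpace M]
    (hE : IsOrthonormalFrame g E (tripleConst a b c)) {x₀ : M} {τ : SmoothFun 3 M}
    (hτ : IsTime E x₀ τ) : ∃ z₁ z₂, IsCoordinates E a b c x₀ z₁ z₂ := by
  have hprim : ∀ f h : SmoothFun 3 M, (E 0).toDerivation f = a • f + b • h →
      (E 0).toDerivation h = c • f + a • h → (E 1).toDerivation h = 0 →
      (E 2).toDerivation f = 0 → ∃ F : SmoothFun 3 M, F x₀ = 0 ∧ (E 0).toDerivation F = 0 ∧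
        (E 1).toDerivation F = f ∧ (E 2).toDerivation F = h := by
    intro f h h1 h2 h3 h4
    refine exists_smoothFun_primitive hE x₀ 0 f h (fun x => ?_) (fun x => ?_) (fun x => ?_)
    · rw [h1, map_zero]; exact sub_zero _
    · rw [h2, map_zero]; exact sub_zero _
    · rw [h3, h4]; exact sub_zero _
  -- The rows u, v solve a linear system that makes their forms in the coframe dual to E₁, E₂
  -- closed, with primitives y, w. The pairs m, k solve the adjoint system and form the inverse
  -- matrix, which turns (y, w) into (z₁, z₂).
  obtain ⟨u₁, u₂, u₁0, u₂0, du₁, du₂, du₁1, du₂1, du₁2, du₂2⟩ := hτ.exists_linear₂ a b c a 1 0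
  obtain ⟨v₁, v₂, v₁0, v₂0, dv₁, dv₂, dv₁1, dv₂1, dv₁2, dv₂2⟩ := hτ.exists_linear₂ a b c a 0 1
  obtain ⟨m₁, m₂, m₁0, m₂0, dm₁, dm₂, dm₁1, dm₂1, dm₁2, dm₂2⟩ :=
    hτ.exists_linear₂ (-a) (-c) (-b) (-a) 1 0
  obtain ⟨k₁, k₂, k₁0, k₂0, dk₁, dk₂, dk₁1, dk₂1, dk₁2, dk₂2⟩ :=
    hτ.exists_linear₂ (-a) (-c) (-b) (-a) 0 1
  obtain ⟨y, y0, dy0, dy1, dy2⟩ := hprim u₁ u₂ du₁ du₂ du₂1 du₁2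
  obtain ⟨w, w0, dw0, dw1, dw2⟩ := hprim v₁ v₂ dv₁ dv₂ dv₂1 dv₁2
  -- A solution of f' = A f and one of h' = -Aᵀ h have constant scalar product.
  have hconst : ∀ f₁ f₂ h₁ h₂ : SmoothFun 3 M, (E 0).toDerivation f₁ = a • f₁ + b • f₂ →
      (E 0).toDerivation f₂ = c • f₁ + a • f₂ → (E 0).toDerivation h₁ = (-a) • h₁ + (-c) • h₂ →
      (E 0).toDerivation h₂ = (-b) • h₁ + (-a) • h₂ → (E 1).toDerivation f₁ = 0 →
      (E 1).toDerivation f₂ = 0 → (E 1).toDerivation h₁ = 0 → (E 1).toDerivation h₂ = 0 →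
      (E 2).toDerivation f₁ = 0 →
      (E 2).toDerivation f₂ = 0 → (E 2).toDerivation h₁ = 0 → (E 2).toDerivation h₂ = 0 →
      ∀ x, f₁ x * h₁ x + f₂ x * h₂ x = f₁ x₀ * h₁ x₀ + f₂ x₀ * h₂ x₀ := by
    intro f₁ f₂ h₁ h₂ e1 e2 e3 e4 e5 e6 e7 e8 e9 e10 e11 e12 x
    refine eq_of_toDerivation_eq_zero hE (f₁ * h₁ + f₂ * h₂) (fun i y => ?_) x x₀
    have : (E i).toDerivation (f₁ * h₁ + f₂ * h₂) = 0 := by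
      fin_cases i
      · simp only [Fin.zero_eta, map_add, Derivation.leibniz, e1, e2, e3, e4, smul_eq_mul]
        simp only [Algebra.smul_def, map_neg]
        ring
      · simp [Derivation.leibniz, e5, e6, e7, e8]
      · simp [Derivation.leibniz, e9, e10, e11, e12]
    rw [this]
    rfl
  have hNM : ∀ x, !![m₁ x, k₁ x; m₂ x, k₂ x] * !![u₁ x, u₂ x; v₁ x, v₂ x] = 1 := by
    intro x
    rw [mul_eq_one_comm]
    have c1 := hconst u₁ u₂ m₁ m₂ du₁ du₂ dm₁ dm₂ du₁1 du₂1 dm₁1 dm₂1 du₁2 du₂2 dm₁2 dm₂2 x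
    have c2 := hconst u₁ u₂ k₁ k₂ du₁ du₂ dk₁ dk₂ du₁1 du₂1 dk₁1 dk₂1 du₁2 du₂2 dk₁2 dk₂2 x
    have c3 := hconst v₁ v₂ m₁ m₂ dv₁ dv₂ dm₁ dm₂ dv₁1 dv₂1 dm₁1 dm₂1 dv₁2 dv₂2 dm₁2 dm₂2 x
    have c4 := hconst v₁ v₂ k₁ k₂ dv₁ dv₂ dk₁ dk₂ dv₁1 dv₂1 dk₁1 dk₂1 dv₁2 dv₂2 dk₁2 dk₂2 x
    rw [Matrix.mul_fin_two, c1, c2, c3, c4, Matrix.one_fin_two]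
    simp [u₁0, u₂0, v₁0, v₂0, m₁0, m₂0, k₁0, k₂0]
  have hent : ∀ x, (m₁ x * u₁ x + k₁ x * v₁ x = 1 ∧ m₁ x * u₂ x + k₁ x * v₂ x = 0) ∧
      m₂ x * u₁ x + k₂ x * v₁ x = 0 ∧ m₂ x * u₂ x + k₂ x * v₂ x = 1 := by
    intro x
    have h := hNM x
    rw [Matrix.mul_fin_two, Matrix.one_fin_two] at h
    simpa using h
  refine ⟨m₁ * y + k₁ * w, m₂ * y + k₂ * w, ?_, ?_, ?_, ?_, ?_, ?_, ?_, ?_⟩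
  · change m₁ x₀ * y x₀ + k₁ x₀ * w x₀ = 0
    simp [y0, w0]
  · change m₂ x₀ * y x₀ + k₂ x₀ * w x₀ = 0
    simp [y0, w0]
  · simp only [map_add, Derivation.leibniz, dy0, dw0, dm₁, dk₁, smul_eq_mul]
    simp only [Algebra.smul_def, map_neg]
    ring
  · simp only [map_add, Derivation.leibniz, dy0, dw0, dm₂, dk₂, smul_eq_mul]
    simp only [Algebra.smul_def, map_neg]
    ring
  · simp only [map_add, Derivation.leibniz, dy1, dw1, dm₁1, dk₁1, smul_zero, add_zero]
    ext x
    exact (hent x).1.1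
  · simp only [map_add, Derivation.leibniz, dy1, dw1, dm₂1, dk₂1, smul_zero, add_zero]
    ext x
    exact (hent x).2.1
  · simp only [map_add, Derivation.leibniz, dy2, dw2, dm₁2, dk₁2, smul_zero, add_zero]
    ext x
    exact (hent x).1.2
  · simp only [map_add, Derivation.leibniz, dy2, dw2, dm₂2, dk₂2, smul_zero, add_zero]
    ext x
    exact (hent x).2.2

end Functions

/-! ### Explicit Killing fields parallel at a point -/

section Fields

set_option linter.unusedSimpArgs false

section Apply

variable {n : ℕ} {M : Type*} [TopologicalSpace M] [ChartedSpace (EuclideanSpace ℝ (Fin n)) M]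

theorem SmoothFun.add_apply (f h : SmoothFun n M) (x : M) : (f + h) x = f x + h x := rfl

theorem SmoothFun.sub_apply (f h : SmoothFun n M) (x : M) : (f - h) x = f x - h x := rfl

theorem SmoothFun.neg_apply (f : SmoothFun n M) (x : M) : (-f) x = -f x := rfl

theorem SmoothFun.mul_apply (f h : SmoothFun n M) (x : M) : (f * h) x = f x * h x := rfl

theorem SmoothFun.smul_apply (t : ℝ) (f : SmoothFun n M) (x : M) : (t • f) x = t * f x := rfl

theorem SmoothFun.one_apply (x : M) : (1 : SmoothFun n M) x = 1 := rfl

theorem SmoothFun.zero_apply (x : M) : (0 : SmoothFun n M) x = 0 := rfl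

variable [IsManifold (𝓡 n) ∞ M] (V : SmoothVF n M)

theorem toDerivation_add_apply (f h : SmoothFun n M) (x : M) :
    V.toDerivation (f + h) x = V.toDerivation f x + V.toDerivation h x := by
  rw [map_add]; rfl

theorem toDerivation_sub_apply (f h : SmoothFun n M) (x : M) :
    V.toDerivation (f - h) x = V.toDerivation f x - V.toDerivation h x := by
  rw [map_sub]; rfl

theorem toDerivation_smul_apply (t : ℝ) (f : SmoothFun n M) (x : M) :
    V.toDerivation (t • f) x = t * V.toDerivation f x := by
  rw [Derivation.map_smul]; rfl

theorem toDerivation_mul_apply (f h : SmoothFun n M) (x : M) :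
    V.toDerivation (f * h) x = f x * V.toDerivation h x + h x * V.toDerivation f x := by
  rw [Derivation.leibniz]; rfl

theorem toDerivation_one_apply (x : M) : V.toDerivation (1 : SmoothFun n M) x = 0 := by
  rw [Derivation.map_one_eq_zero]; rfl

end Apply

variable {M : Type*} [TopologicalSpace M] [ChartedSpace (EuclideanSpace ℝ (Fin 3)) M]
  [IsManifold (𝓡 3) ∞ M] [SimplyConnectedSpace M] {g : SmoothMetric 3 M} {E : Fin 3 → SmoothVF 3 M}
  {a b c : ℝ}

/-- The field commutes with the frame, so on the group it is right-invariant. It is parallel at x₀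
because ad e₀ is symmetric. -/
theorem frame₀_mem_of_symmetric (hE : IsOrthonormalFrame g E (tripleConst a b b)) (x₀ : M) :
    E 0 x₀ ∈ symmetrySubspace g x₀ := by
  obtain ⟨τ, hτ⟩ := exists_isTime hE x₀
  obtain ⟨z₁, z₂, hz⟩ := hτ.exists_isCoordinates hE
  refine mem_symmetrySubspace_of_killing hE (p := 1) (q := a • z₁ + b • z₂)
    (r := b • z₁ + a • z₂) ?_ ?_ ?_
  · simp [SmoothFun.add_apply, SmoothFun.sub_apply, SmoothFun.neg_apply, SmoothFun.mul_apply,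
      SmoothFun.smul_apply, SmoothFun.one_apply, SmoothFun.zero_apply, toDerivation_add_apply,
      toDerivation_sub_apply, toDerivation_smul_apply, toDerivation_mul_apply,
      toDerivation_one_apply, map_zero, hz.zero₁, hz.zero₂]
  · intro x
    simp only [SmoothFun.add_apply, SmoothFun.sub_apply, SmoothFun.neg_apply, SmoothFun.mul_apply,
      SmoothFun.smul_apply, SmoothFun.one_apply, SmoothFun.zero_apply, toDerivation_add_apply,
      toDerivation_sub_apply, toDerivation_smul_apply, toDerivation_mul_apply,
      toDerivation_one_apply, map_zero, hz.d₀₁, hz.d₀₂, hz.d₁₁, hz.d₁₂, hz.d₂₁, hz.d₂₂]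
    refine ⟨?_, ?_, ?_, ?_, ?_, ?_⟩ <;> first | trivial | ring
  · simp only [SmoothFun.add_apply, SmoothFun.sub_apply, SmoothFun.neg_apply, SmoothFun.mul_apply,
      SmoothFun.smul_apply, SmoothFun.one_apply, SmoothFun.zero_apply, toDerivation_add_apply,
      toDerivation_sub_apply, toDerivation_smul_apply, toDerivation_mul_apply,
      toDerivation_one_apply, map_zero, hz.d₀₁, hz.d₀₂, hz.d₁₁, hz.d₁₂, hz.d₂₁, hz.d₂₂, hz.zero₁, hz.zero₂]
    refine ⟨?_, ?_, ?_⟩ <;> first | trivial | ring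

/-- Again a field commuting with the frame, now in the abelian ideal, so its coefficients depend on
τ only. Closedness of its dual form at x₀ amounts to b + c = 2a. -/
theorem sub_mem_of_add_eq (hE : IsOrthonormalFrame g E (tripleConst a b c)) (h : b + c = 2 * a)
    (x₀ : M) : E 1 x₀ - E 2 x₀ ∈ symmetrySubspace g x₀ := by
  obtain ⟨τ, hτ⟩ := exists_isTime hE x₀
  obtain ⟨q, r, q0, r0, dq₀, dr₀, dq₁, dr₁, dq₂, dr₂⟩ :=
    hτ.exists_linear₂ (-a) (-c) (-b) (-a) 1 (-1)
  refine mem_symmetrySubspace_of_killing hE (p := 0) (q := q) (r := r) ?_ ?_ ?_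
  · simp [SmoothFun.add_apply, SmoothFun.sub_apply, SmoothFun.neg_apply, SmoothFun.mul_apply,
      SmoothFun.smul_apply, SmoothFun.one_apply, SmoothFun.zero_apply, toDerivation_add_apply,
      toDerivation_sub_apply, toDerivation_smul_apply, toDerivation_mul_apply,
      toDerivation_one_apply, map_zero, q0, r0, sub_eq_add_neg]
  · intro x
    simp only [SmoothFun.add_apply, SmoothFun.sub_apply, SmoothFun.neg_apply, SmoothFun.mul_apply,
      SmoothFun.smul_apply, SmoothFun.one_apply, SmoothFun.zero_apply, toDerivation_add_apply,
      toDerivation_sub_apply, toDerivation_smul_apply, toDerivation_mul_apply,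
      toDerivation_one_apply, map_zero, dq₀, dr₀, dq₁, dr₁, dq₂, dr₂]
    refine ⟨?_, ?_, ?_, ?_, ?_, ?_⟩ <;> first | trivial | ring
  · simp only [SmoothFun.add_apply, SmoothFun.sub_apply, SmoothFun.neg_apply, SmoothFun.mul_apply,
      SmoothFun.smul_apply, SmoothFun.one_apply, SmoothFun.zero_apply, toDerivation_add_apply,
      toDerivation_sub_apply, toDerivation_smul_apply, toDerivation_mul_apply,
      toDerivation_one_apply, map_zero, dq₀, dr₀, dq₁, dr₁, dq₂, dr₂, q0, r0]
    refine ⟨?_, ?_, ?_⟩ <;> first | trivial | linarith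

theorem add_mem_of_symmetric (hE : IsOrthonormalFrame g E (tripleConst a a a)) (x₀ : M) :
    E 1 x₀ + E 2 x₀ ∈ symmetrySubspace g x₀ := by
  obtain ⟨τ, hτ⟩ := exists_isTime hE x₀
  obtain ⟨z₁, z₂, hz⟩ := hτ.exists_isCoordinates hE
  -- For a ≠ 0 the metric is locally a hyperbolic plane of curvature -4a² times a line. With α =
  -- exp(-2aτ) and β = exp(2aτ), the field is the mean of two parabolic fields fixing opposite ends
  -- of the E₀-geodesic: the one with coefficient α commutes with the frame, the other is its mirror
  -- image. Their covariant derivatives at x₀ cancel.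
  obtain ⟨α, α0, dα₀, dα₁, dα₂⟩ := hτ.exists_linear₁ (-(2 * a)) 1
  obtain ⟨β, β0, dβ₀, dβ₁, dβ₂⟩ := hτ.exists_linear₁ (2 * a) 1
  let q : SmoothFun 3 M := (1 / 2 : ℝ) • (α + β - (2 * a ^ 2) • (β * ((z₁ + z₂) * (z₁ + z₂))))
  refine mem_symmetrySubspace_of_killing hE (p := (-(2 * a)) • (β * (z₁ + z₂))) (q := q)
    (r := q) ?_ ?_ ?_
  · simp [q, SmoothFun.add_apply, SmoothFun.sub_apply, SmoothFun.neg_apply, SmoothFun.mul_apply,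
      SmoothFun.smul_apply, SmoothFun.one_apply, SmoothFun.zero_apply, toDerivation_add_apply,
      toDerivation_sub_apply, toDerivation_smul_apply, toDerivation_mul_apply,
      toDerivation_one_apply, map_zero, hz.zero₁, hz.zero₂, α0, β0]
    norm_num
  · intro x
    simp only [q, SmoothFun.add_apply, SmoothFun.sub_apply, SmoothFun.neg_apply, SmoothFun.mul_apply,
      SmoothFun.smul_apply, SmoothFun.one_apply, SmoothFun.zero_apply, toDerivation_add_apply,
      toDerivation_sub_apply, toDerivation_smul_apply, toDerivation_mul_apply,
      toDerivation_one_apply, map_zero, hz.d₀₁, hz.d₀₂, hz.d₁₁, hz.d₁₂, hz.d₂₁, hz.d₂₂, dα₀, dα₁, dα₂, dβ₀, dβ₁, dβ₂]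
    refine ⟨?_, ?_, ?_, ?_, ?_, ?_⟩ <;> first | trivial | ring
  · simp only [q, SmoothFun.add_apply, SmoothFun.sub_apply, SmoothFun.neg_apply, SmoothFun.mul_apply,
      SmoothFun.smul_apply, SmoothFun.one_apply, SmoothFun.zero_apply, toDerivation_add_apply,
      toDerivation_sub_apply, toDerivation_smul_apply, toDerivation_mul_apply,
      toDerivation_one_apply, map_zero, hz.d₀₁, hz.d₀₂, hz.d₁₁, hz.d₁₂, hz.d₂₁, hz.d₂₂, dα₀, dα₁, dα₂, dβ₀, dβ₁,
      dβ₂, hz.zero₁, hz.zero₂, α0, β0]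
    refine ⟨?_, ?_, ?_⟩ <;> first | trivial | ring

/-- The field commuting with the frame, minus b times the rotation z₁ E₂ - z₂ E₁. This leaves the
transvection along the E₀-geodesic. -/
theorem frame₀_mem_of_opposite (hE : IsOrthonormalFrame g E (tripleConst a b (-b))) (x₀ : M) :
    E 0 x₀ ∈ symmetrySubspace g x₀ := by
  obtain ⟨τ, hτ⟩ := exists_isTime hE x₀
  obtain ⟨z₁, z₂, hz⟩ := hτ.exists_isCoordinates hE
  refine mem_symmetrySubspace_of_killing hE (p := 1) (q := a • z₁) (r := a • z₂) ?_ ?_ ?_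
  · simp [SmoothFun.add_apply, SmoothFun.sub_apply, SmoothFun.neg_apply, SmoothFun.mul_apply,
      SmoothFun.smul_apply, SmoothFun.one_apply, SmoothFun.zero_apply, toDerivation_add_apply,
      toDerivation_sub_apply, toDerivation_smul_apply, toDerivation_mul_apply,
      toDerivation_one_apply, map_zero, hz.zero₁, hz.zero₂]
  · intro x
    simp only [SmoothFun.add_apply, SmoothFun.sub_apply, SmoothFun.neg_apply, SmoothFun.mul_apply,
      SmoothFun.smul_apply, SmoothFun.one_apply, SmoothFun.zero_apply, toDerivation_add_apply,
      toDerivation_sub_apply, toDerivation_smul_apply, toDerivation_mul_apply,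
      toDerivation_one_apply, map_zero, hz.d₀₁, hz.d₀₂, hz.d₁₁, hz.d₁₂, hz.d₂₁, hz.d₂₂]
    refine ⟨?_, ?_, ?_, ?_, ?_, ?_⟩ <;> first | trivial | ring
  · simp only [SmoothFun.add_apply, SmoothFun.sub_apply, SmoothFun.neg_apply, SmoothFun.mul_apply,
      SmoothFun.smul_apply, SmoothFun.one_apply, SmoothFun.zero_apply, toDerivation_add_apply,
      toDerivation_sub_apply, toDerivation_smul_apply, toDerivation_mul_apply,
      toDerivation_one_apply, map_zero, hz.d₀₁, hz.d₀₂, hz.d₁₁, hz.d₁₂, hz.d₂₁, hz.d₂₂, hz.zero₁, hz.zero₂]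
    refine ⟨?_, ?_, ?_⟩ <;> first | trivial | ring

theorem combination_mem_of_opposite (hE : IsOrthonormalFrame g E (tripleConst a b (-b))) (x₀ : M)
    (s t : ℝ) : s • E 1 x₀ + t • E 2 x₀ ∈ symmetrySubspace g x₀ := by
  obtain ⟨τ, hτ⟩ := exists_isTime hE x₀
  obtain ⟨z₁, z₂, hz⟩ := hτ.exists_isCoordinates hE
  obtain ⟨α, α0, dα₀, dα₁, dα₂⟩ := hτ.exists_linear₁ (-a) 1
  obtain ⟨β, β0, dβ₀, dβ₁, dβ₂⟩ := hτ.exists_linear₁ a 1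
  -- The pair m, n undoes the rotation by bτ of E₁, E₂, so that m E₁ + n E₂ is only scaled by the
  -- bracket with E₀. For a ≠ 0, in the half-space model, the field below is the mean of a
  -- horospherical translation and a special conformal field; for a = 0 it is a Euclidean
  -- translation.
  obtain ⟨m, n, m0, n0, dm₀, dn₀, dm₁, dn₁, dm₂, dn₂⟩ := hτ.exists_linear₂ 0 b (-b) 0 s t
  let u : SmoothFun 3 M := β * (m * z₁ + n * z₂)
  let w : SmoothFun 3 M :=
    (1 / 2 : ℝ) • (α + β + a ^ 2 • (β * (z₁ * z₁ + z₂ * z₂)))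
  refine mem_symmetrySubspace_of_killing hE (p := (-a) • u)
    (q := w * m - a ^ 2 • (u * z₁)) (r := w * n - a ^ 2 • (u * z₂)) ?_ ?_ ?_
  · simp [u, w, SmoothFun.add_apply, SmoothFun.sub_apply, SmoothFun.neg_apply, SmoothFun.mul_apply,
      SmoothFun.smul_apply, SmoothFun.one_apply, SmoothFun.zero_apply, toDerivation_add_apply,
      toDerivation_sub_apply, toDerivation_smul_apply, toDerivation_mul_apply,
      toDerivation_one_apply, map_zero, hz.zero₁, hz.zero₂, α0, β0, m0, n0]
    norm_num
  · intro x
    simp only [u, w, SmoothFun.add_apply, SmoothFun.sub_apply, SmoothFun.neg_apply, SmoothFun.mul_apply,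
      SmoothFun.smul_apply, SmoothFun.one_apply, SmoothFun.zero_apply, toDerivation_add_apply,
      toDerivation_sub_apply, toDerivation_smul_apply, toDerivation_mul_apply,
      toDerivation_one_apply, map_zero, hz.d₀₁, hz.d₀₂, hz.d₁₁, hz.d₁₂, hz.d₂₁, hz.d₂₂, dα₀, dα₁, dα₂, dβ₀, dβ₁,
      dβ₂, dm₀, dm₁, dm₂, dn₀, dn₁, dn₂]
    refine ⟨?_, ?_, ?_, ?_, ?_, ?_⟩ <;> first | trivial | ring
  · simp only [u, w, SmoothFun.add_apply, SmoothFun.sub_apply, SmoothFun.neg_apply, SmoothFun.mul_apply,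
      SmoothFun.smul_apply, SmoothFun.one_apply, SmoothFun.zero_apply, toDerivation_add_apply,
      toDerivation_sub_apply, toDerivation_smul_apply, toDerivation_mul_apply,
      toDerivation_one_apply, map_zero, hz.d₀₁, hz.d₀₂, hz.d₁₁, hz.d₁₂, hz.d₂₁, hz.d₂₂, dα₀, dα₁, dα₂, dβ₀, dβ₁,
      dβ₂, dm₀, dm₁, dm₂, dn₀, dn₁, dn₂, hz.zero₁, hz.zero₂, α0, β0, m0, n0]
    refine ⟨?_, ?_, ?_⟩ <;> first | trivial | ring

/-- The vector spans the kernel of ad e₀ on the ideal, so its field is Killing but in general not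
parallel. Adding t = (b - c)/2 times a rotation about x₀ cancels its covariant derivative there. -/
theorem central_mem (hE : IsOrthonormalFrame g E (tripleConst a b c)) (hb : b ≠ 0)
    (h : b * c = a ^ 2) (x₀ : M) : a • E 1 x₀ - b • E 2 x₀ ∈ symmetrySubspace g x₀ := by
  obtain rfl : c = a ^ 2 / b := by rw [← h]; field_simp
  have hab : a ^ 2 + b ^ 2 ≠ 0 := by positivity
  obtain ⟨τ, hτ⟩ := exists_isTime hE x₀
  obtain ⟨z₁, z₂, hz⟩ := hτ.exists_isCoordinates hE
  -- H'' = 4a² H + 1 with zero initial data, the constant 1 being carried as a third unknown. So G =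
  -- H' is sinh(2aτ)/(2a), or τ when a = 0, which covers both cases without dividing by a.
  obtain ⟨f, f0, df₀, df₁, df₂⟩ := hτ.exists_linear !![0, 1, 0; 4 * a ^ 2, 0, 1; 0, 0, 0] ![0, 0, 1]
  have f2 : f 2 = 1 := by
    ext x
    rw [eq_of_toDerivation_eq_zero hE (f 2) (fun i y => ?_) x x₀, f0 2]
    · rfl
    · fin_cases i
      · simp [df₀, Fin.sum_univ_three, SmoothFun.zero_apply]
      · simp [df₁, SmoothFun.zero_apply]
      · simp [df₂, SmoothFun.zero_apply]
  have dH : (E 0).toDerivation (f 0) = f 1 := by simp [df₀, Fin.sum_univ_three]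
  have dG : (E 0).toDerivation (f 1) = (4 * a ^ 2) • f 0 + 1 := by
    simp [df₀, Fin.sum_univ_three, f2]
  have H0 : f 0 x₀ = 0 := f0 0
  have G0 : f 1 x₀ = 0 := f0 1
  have dH₁ := df₁ 0
  have dG₁ := df₁ 1
  have dH₂ := df₂ 0
  have dG₂ := df₂ 1
  generalize f 0 = H at *
  generalize f 1 = G at *
  let t : ℝ := (b - a ^ 2 / b) / 2
  -- μ is constant along the central direction and β = exp(2aτ). The functions μβ, u and w are the
  -- coefficients of the rotation along E₀, b E₁ + a E₂ and the central field; all three vanish at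
  -- x₀.
  let μ : SmoothFun 3 M := b • z₁ + a • z₂
  let β : SmoothFun 3 M := 1 + (4 * a ^ 2) • H + (2 * a) • G
  let u : SmoothFun 3 M := (a / (a ^ 2 + b ^ 2)) • (μ * μ * β) - G
  let w : SmoothFun 3 M := (-(2 * t)) • ((1 / (2 * (a ^ 2 + b ^ 2))) • (μ * μ * β) + H)
  refine mem_symmetrySubspace_of_killing hE (p := t • (μ * β))
    (q := a • 1 + t • (b • u + a • w)) (r := (-b) • 1 + t • (a • u - b • w)) ?_ ?_ ?_
  · simp [u, w, μ, β, SmoothFun.add_apply, SmoothFun.sub_apply, SmoothFun.neg_apply, SmoothFun.mul_apply,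
      SmoothFun.smul_apply, SmoothFun.one_apply, SmoothFun.zero_apply, toDerivation_add_apply,
      toDerivation_sub_apply, toDerivation_smul_apply, toDerivation_mul_apply,
      toDerivation_one_apply, map_zero, hz.zero₁, hz.zero₂, H0, G0, sub_eq_add_neg]
  · intro x
    simp only [u, w, μ, β, t, SmoothFun.add_apply, SmoothFun.sub_apply, SmoothFun.neg_apply, SmoothFun.mul_apply,
      SmoothFun.smul_apply, SmoothFun.one_apply, SmoothFun.zero_apply, toDerivation_add_apply,
      toDerivation_sub_apply, toDerivation_smul_apply, toDerivation_mul_apply,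
      toDerivation_one_apply, map_zero, hz.d₀₁, hz.d₀₂, hz.d₁₁, hz.d₁₂, hz.d₂₁, hz.d₂₂, dH, dG, dH₁, dG₁,
      dH₂, dG₂]
    refine ⟨?_, ?_, ?_, ?_, ?_, ?_⟩ <;> field_simp <;> ring
  · simp only [u, w, μ, β, t, SmoothFun.add_apply, SmoothFun.sub_apply, SmoothFun.neg_apply, SmoothFun.mul_apply,
      SmoothFun.smul_apply, SmoothFun.one_apply, SmoothFun.zero_apply, toDerivation_add_apply,
      toDerivation_sub_apply, toDerivation_smul_apply, toDerivation_mul_apply,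
      toDerivation_one_apply, map_zero, hz.d₀₁, hz.d₀₂, hz.d₁₁, hz.d₁₂, hz.d₂₁, hz.d₂₂, dH, dG, dH₁, dG₁,
      dH₂, dG₂, hz.zero₁, hz.zero₂, H0, G0]
    refine ⟨?_, ?_, ?_⟩ <;> field_simp <;> ring

end Fields

/-! ### Identification with the table -/

section Table

variable {G : Type*} [TopologicalSpace G] [ChartedSpace (EuclideanSpace ℝ (Fin 3)) G] [Group G]
  [LieGroup (𝓡 3) ∞ G] {g : SmoothMetric 3 G} {e : Fin 3 → GroupLieAlgebra (𝓡 3) G} {a b c : ℝ}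

theorem lieGroup_minSmoothness (G : Type*) [TopologicalSpace G]
    [ChartedSpace (EuclideanSpace ℝ (Fin 3)) G] [Group G] [LieGroup (𝓡 3) ∞ G] :
    LieGroup (𝓡 3) (minSmoothness ℝ 3) G :=
  LieGroup.of_le (n := ∞) (by
    rw [minSmoothness_of_isRCLikeNormedField]; exact WithTop.coe_le_coe.2 le_top)

theorem bracket_smul_smul (s t : ℝ) (v w : GroupLieAlgebra (𝓡 3) G) :
    ⁅s • v, t • w⁆ = (s * t) • ⁅v, w⁆ := by
  have := lieGroup_minSmoothness G
  have h₁ : ⁅s • v, t • w⁆ = s • ⁅v, t • w⁆ := smul_lie s v (t • w)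
  have h₂ : ⁅v, t • w⁆ = t • ⁅v, w⁆ := lie_smul t v w
  rw [h₁, h₂, smul_smul]

theorem DefinesTriple.linearIndependent (hg : IsLeftInvariant g) (he : DefinesTriple g e a b c) :
    LinearIndependent ℝ e := by
  simpa only [leftInvariantField_one] using (he.isOrthonormalFrame hg).linearIndependent 1

/-- The basis x e₀, e₁, y e₂ has the coefficients xa, xb/y, xyc, xa. -/
theorem DefinesTriple.hasBracketBasis (hg : IsLeftInvariant g) (he : DefinesTriple g e a b c)
    {x y p q r : ℝ} (hx : x ≠ 0) (hy : y ≠ 0) (hp : x * a = p) (hq : q * y = x * b)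
    (hr : x * y * c = r) : HasBracketBasis (GroupLieAlgebra (𝓡 3) G) p q r p := by
  let B := basisOfLinearIndependentOfCardEqFinrank (he.linearIndependent hg)
    ((Fintype.card_fin 3).trans finrank_euclideanSpace_fin.symm)
  have hw : ∀ i, IsUnit ((![x, 1, y] : Fin 3 → ℝ) i) := fun i => by
    fin_cases i <;> simp [hx, hy]
  have h0 : B.isUnitSMul hw 0 = x • e 0 := by simp [B, Basis.isUnitSMul_apply]
  have h1 : B.isUnitSMul hw 1 = (1 : ℝ) • e 1 := by simp [B, Basis.isUnitSMul_apply]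
  have h2 : B.isUnitSMul hw 2 = y • e 2 := by simp [B, Basis.isUnitSMul_apply]
  refine ⟨B.isUnitSMul hw, ?_, ?_, ?_⟩
  · rw [h0, h1, h2, bracket_smul_smul, he.bracket_01, ← hp, smul_smul q, hq]
    module
  · rw [h0, h1, h2, bracket_smul_smul, he.bracket_02, ← hp, ← hr]
    module
  · rw [h1, h2, bracket_smul_smul, he.bracket_12, smul_zero]

theorem DefinesTriple.isTypeOf_gK (hg : IsLeftInvariant g) (he : DefinesTriple g e a b c)
    {K : ℝ} (ha : 0 < a) (hb : 0 < b) (h : b * c / a ^ 2 = K) :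
    (AlgebraType.gK K).IsTypeOf (GroupLieAlgebra (𝓡 3) G) :=
  he.hasBracketBasis hg (x := a⁻¹) (y := b / a) (by positivity) (by positivity) (by field_simp)
    (by field_simp) (by rw [← h]; field_simp)

theorem DefinesTriple.symmetrySubspace_eq_top (hg : IsLeftInvariant g)
    (he : DefinesTriple g e a b c) (h0 : e 0 ∈ symmetrySubspace g (1 : G))
    (h1 : e 1 ∈ symmetrySubspace g (1 : G)) (h2 : e 2 ∈ symmetrySubspace g (1 : G)) :
    symmetrySubspace g (1 : G) = ⊤ := by
  refine eq_top_iff.2 fun v _ => ?_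
  rw [(he.isOrthonormalFrame hg).eq_sum 1 v]
  refine Submodule.sum_mem _ fun i _ => Submodule.smul_mem _ _ ?_
  rw [leftInvariantField_one]
  fin_cases i
  exacts [h0, h1, h2]

theorem indexOfSymmetry_of_eq_top (h : symmetrySubspace g (1 : G) = ⊤) : indexOfSymmetry g = 3 := by
  rw [indexOfSymmetry, h, finrank_top]
  exact finrank_euclideanSpace_fin

theorem indexOfSymmetry_of_eq_bot (h : symmetrySubspace g (1 : G) = ⊥) : indexOfSymmetry g = 0 := by
  rw [indexOfSymmetry, h, finrank_bot]

theorem indexOfSymmetry_of_eq_span {v : GroupLieAlgebra (𝓡 3) G} (hv : v ≠ 0)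
    (h : symmetrySubspace g (1 : G) = ℝ ∙ v) : indexOfSymmetry g = 1 := by
  rw [indexOfSymmetry, h]
  exact finrank_span_singleton hv

theorem DefinesTriple.combination_ne_zero (hg : IsLeftInvariant g) (he : DefinesTriple g e a b c)
    {s t : ℝ} (ht : t ≠ 0) : s • e 1 - t • e 2 ≠ 0 := by
  intro h
  have := Fintype.linearIndependent_iff.1 (he.linearIndependent hg) ![0, s, -t]
    (by simpa [Fin.sum_univ_three, sub_eq_add_neg] using h) 2
  simp [ht] at this

theorem DefinesTriple.constraints (hg : IsLeftInvariant g) (he : DefinesTriple g e a b c)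
    (hbc : b + c ≠ 0) {v : GroupLieAlgebra (𝓡 3) G} (hv : v ∈ symmetrySubspace g (1 : G)) :
    ∃ P Q R : ℝ, v = P • e 0 + Q • e 1 + R • e 2 ∧ (b - c) * P = 0 ∧
      (2 * a ^ 2 - b * (b + c)) * Q = a * (b - c) * R ∧
      (2 * a ^ 2 - c * (b + c)) * R = - (a * (b - c) * Q) ∧
      (a ^ 2 - b * c) * (2 * a * Q + (b + c) * R) = 0 ∧
      (a ^ 2 - b * c) * ((b + c) * Q + 2 * a * R) = 0 := by
  simpa only [leftInvariantField_one] using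
    symmetrySubspace_constraints (he.isOrthonormalFrame hg) hbc hv

/-- b ≠ c kills the e₀-component; after division by a² - bc, the other two components satisfy a
linear system with determinant a nonzero multiple of (b + c)² - 4a². -/
theorem symmetrySubspace_eq_bot (hg : IsLeftInvariant g) (he : DefinesTriple g e a b c)
    (h₁ : b ≠ c) (h₂ : b + c ≠ 0) (h₃ : b + c ≠ 2 * a) (h₄ : b * c ≠ a ^ 2) :
    symmetrySubspace g (1 : G) = ⊥ := by
  have ha := he.a_nonneg
  have hc := neg_le_of_abs_le he.abs_le
  refine (Submodule.eq_bot_iff _).2 fun v hv => ?_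
  obtain ⟨P, Q, R, rfl, hP, -, -, hQ, hR⟩ := he.constraints hg h₂ hv
  have hne : b - c ≠ 0 := sub_ne_zero.2 h₁
  have hac : a ^ 2 - b * c ≠ 0 := sub_ne_zero.2 h₄.symm
  have hpos : 0 < b + c := lt_of_le_of_ne (by linarith) h₂.symm
  have hdet : (b + c - 2 * a) * (b + c + 2 * a) ≠ 0 :=
    mul_ne_zero (sub_ne_zero.2 h₃) (by positivity)
  have hP0 : P = 0 := by simpa [hne] using hP
  replace hQ := (mul_eq_zero.1 hQ).resolve_left hac
  replace hR := (mul_eq_zero.1 hR).resolve_left hac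
  have hQ0 : Q = 0 := (mul_eq_zero.1 (by linear_combination (b + c) * hR - 2 * a * hQ :
    (b + c - 2 * a) * (b + c + 2 * a) * Q = 0)).resolve_left hdet
  have hR0 : R = 0 := (mul_eq_zero.1 (by linear_combination (b + c) * hQ - 2 * a * hR :
    (b + c - 2 * a) * (b + c + 2 * a) * R = 0)).resolve_left hdet
  rw [hP0, hQ0, hR0]
  module

variable [SimplyConnectedSpace G]

theorem symmetrySubspace_of_opposite (hg : IsLeftInvariant g) (he : DefinesTriple g e a b (-b)) :
    symmetrySubspace g (1 : G) = ⊤ := by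
  have hE := he.isOrthonormalFrame hg
  refine he.symmetrySubspace_eq_top hg ?_ ?_ ?_
  · simpa only [leftInvariantField_one] using frame₀_mem_of_opposite hE 1
  · simpa only [leftInvariantField_one, one_smul, zero_smul, add_zero] using
      combination_mem_of_opposite hE 1 1 0
  · simpa only [leftInvariantField_one, one_smul, zero_smul, zero_add] using
      combination_mem_of_opposite hE 1 0 1

theorem symmetrySubspace_of_all_eq (hg : IsLeftInvariant g) (he : DefinesTriple g e a a a) :
    symmetrySubspace g (1 : G) = ⊤ := by
  have hE := he.isOrthonormalFrame hg
  have hadd := add_mem_of_symmetric hE 1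
  have hsub := sub_mem_of_add_eq hE (by ring) 1
  simp only [leftInvariantField_one] at hadd hsub
  refine he.symmetrySubspace_eq_top hg ?_ ?_ ?_
  · simpa only [leftInvariantField_one] using frame₀_mem_of_symmetric hE 1
  · have := Submodule.smul_mem _ (1 / 2 : ℝ) (Submodule.add_mem _ hadd hsub)
    convert this using 1
    module
  · have := Submodule.smul_mem _ (1 / 2 : ℝ) (Submodule.sub_mem _ hadd hsub)
    convert this using 1
    module

theorem symmetrySubspace_of_symmetric (hg : IsLeftInvariant g) (he : DefinesTriple g e a b b)
    (hb : 0 < b) (hab : a ≠ b) : symmetrySubspace g (1 : G) = ℝ ∙ e 0 := by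
  have ha := he.a_nonneg
  apply le_antisymm
  · intro v hv
    obtain ⟨P, Q, R, rfl, -, hQ, hR, -⟩ := he.constraints hg (by positivity) hv
    have hne : 2 * a ^ 2 - b * (b + b) ≠ 0 := by
      have : (a - b) * (a + b) ≠ 0 := mul_ne_zero (sub_ne_zero.2 hab) (by positivity)
      contrapose! this
      linarith
    have hQ0 : Q = 0 := by simpa [hne] using hQ
    have hR0 : R = 0 := by simpa [hne] using hR
    rw [hQ0, hR0, zero_smul, zero_smul, add_zero, add_zero]
    exact Submodule.smul_mem _ _ (Submodule.mem_span_singleton_self _)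
  · rw [Submodule.span_singleton_le_iff_mem]
    simpa only [leftInvariantField_one] using frame₀_mem_of_symmetric (he.isOrthonormalFrame hg) 1

theorem symmetrySubspace_of_mul_eq (hg : IsLeftInvariant g) (he : DefinesTriple g e a b c)
    (hb : 0 < b) (hbc : b ≠ c) (h : b * c = a ^ 2) :
    symmetrySubspace g (1 : G) = ℝ ∙ (a • e 1 - b • e 2) := by
  have hc : 0 ≤ c := nonneg_of_mul_nonneg_right (h ▸ sq_nonneg a) hb
  apply le_antisymm
  · intro v hv
    obtain ⟨P, Q, R, rfl, hP, hQ, hR, -⟩ := he.constraints hg (by positivity) hv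
    have hne : b - c ≠ 0 := sub_ne_zero.2 hbc
    have hP0 : P = 0 := by simpa [hne] using hP
    have hQR : b * Q + a * R = 0 := by
      have : (b - c) * (b * Q + a * R) = 0 := by linear_combination -hQ - 2 * Q * h
      simpa [hne] using this
    refine Submodule.mem_span_singleton.2 ⟨-R / b, ?_⟩
    have hQ' : Q = -R / b * a := by field_simp; linarith
    have hR' : R = - (-R / b * b) := by field_simp
    rw [hP0, hQ']
    nth_rewrite 3 [hR']
    module
  · rw [Submodule.span_singleton_le_iff_mem]
    simpa only [leftInvariantField_one] using
      central_mem (he.isOrthonormalFrame hg) hb.ne' h 1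

theorem symmetrySubspace_of_add_eq (hg : IsLeftInvariant g) (he : DefinesTriple g e a b c)
    (ha : 0 < a) (hbc : b ≠ c) (h : b + c = 2 * a) :
    symmetrySubspace g (1 : G) = ℝ ∙ (e 1 - e 2) := by
  apply le_antisymm
  · intro v hv
    obtain ⟨P, Q, R, rfl, hP, hQ, -⟩ := he.constraints hg (by rw [h]; positivity) hv
    have hne : b - c ≠ 0 := sub_ne_zero.2 hbc
    have hP0 : P = 0 := by simpa [hne] using hP
    have hQR : R = -Q := by
      have : a * (b - c) * (Q + R) = 0 := by
        linear_combination -hQ - Q * (b + a) * h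
      have : Q + R = 0 := by simpa [hne, ha.ne'] using this
      linarith
    refine Submodule.mem_span_singleton.2 ⟨Q, ?_⟩
    rw [hP0, hQR]
    module
  · rw [Submodule.span_singleton_le_iff_mem]
    simpa only [leftInvariantField_one] using
      sub_mem_of_add_eq (he.isOrthonormalFrame hg) h 1

theorem symmetrySubspace_of_tableRow (hg : IsLeftInvariant g) (he : DefinesTriple g e a b c)
    {t : AlgebraType} {S : Submodule ℝ (GroupLieAlgebra (𝓡 3) G)} {i : ℕ}
    (h : TableRow e t a b c S i) :
    t.IsTypeOf (GroupLieAlgebra (𝓡 3) G) ∧ symmetrySubspace g (1 : G) = S ∧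
      indexOfSymmetry g = i := by
  have h0 : e 0 ≠ 0 := (he.linearIndependent hg).ne_zero 0
  have h2 : e 2 ≠ 0 := (he.linearIndependent hg).ne_zero 2
  have h12 : e 1 - e 2 ≠ 0 := by
    simpa using he.combination_ne_zero hg (s := 1) (t := 1) one_ne_zero
  have opp : ∀ {a b : ℝ}, DefinesTriple g e a b (-b) →
      symmetrySubspace g (1 : G) = ⊤ ∧ indexOfSymmetry g = 3 := fun he =>
    have := symmetrySubspace_of_opposite hg he
    ⟨this, indexOfSymmetry_of_eq_top this⟩
  have symm : ∀ {a b : ℝ}, DefinesTriple g e a b b → 0 < b → a ≠ b →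
      symmetrySubspace g (1 : G) = ℝ ∙ e 0 ∧ indexOfSymmetry g = 1 := fun he hb hab =>
    have := symmetrySubspace_of_symmetric hg he hb hab
    ⟨this, indexOfSymmetry_of_eq_span h0 this⟩
  have sqrt : ∀ {a b c : ℝ}, DefinesTriple g e a b c → 0 < a → b ≠ c → b + c = 2 * a →
      symmetrySubspace g (1 : G) = ℝ ∙ (e 1 - e 2) ∧ indexOfSymmetry g = 1 := fun he ha hbc h =>
    have := symmetrySubspace_of_add_eq hg he ha hbc h
    ⟨this, indexOfSymmetry_of_eq_span h12 this⟩
  have sqrt' : ∀ {K a : ℝ}, DefinesTriple g e a (a + a * √(1 - K)) (a - a * √(1 - K)) →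
      K < 1 → 0 < a → (AlgebraType.gK K).IsTypeOf (GroupLieAlgebra (𝓡 3) G) ∧
        symmetrySubspace g (1 : G) = ℝ ∙ (e 1 - e 2) ∧ indexOfSymmetry g = 1 := by
    intro K a he hK ha
    have hs : 0 < √(1 - K) := Real.sqrt_pos.2 (by linarith)
    have hs2 : √(1 - K) ^ 2 = 1 - K := Real.sq_sqrt (by linarith)
    have hm : 0 < a * √(1 - K) := by positivity
    refine ⟨he.isTypeOf_gK hg ha (by positivity) ?_, sqrt he ha (by linarith) (by ring)⟩
    field_simp
    linear_combination -hs2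
  cases h with
  | gK_gt_one K _ _ hK ha hb h =>
    refine ⟨he.isTypeOf_gK hg ha hb h, symm he hb ?_⟩
    rintro rfl
    rw [← h, ← sq, div_self (by positivity)] at hK
    exact lt_irrefl _ hK
  | g1_eq _ _ ha hb h =>
    refine ⟨he.isTypeOf_gK hg ha hb h, ?_⟩
    rw [div_eq_one_iff_eq (by positivity), ← sq, pow_left_inj₀ hb.le ha.le two_ne_zero] at h
    subst h
    have := symmetrySubspace_of_all_eq hg he
    exact ⟨this, indexOfSymmetry_of_eq_top this⟩
  | g1_ne _ _ _ ha hb hbc h =>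
    refine ⟨he.isTypeOf_gK hg ha hb h, ?_⟩
    rw [div_eq_one_iff_eq (by positivity)] at h
    have := symmetrySubspace_of_mul_eq hg he hb hbc h
    exact ⟨this, indexOfSymmetry_of_eq_span (he.combination_ne_zero hg hb.ne') this⟩
  | gK_mid_eq K _ _ hK0 hK1 ha hb h =>
    refine ⟨he.isTypeOf_gK hg ha hb h, symm he hb ?_⟩
    rintro rfl
    rw [← h, ← sq, div_self (by positivity)] at hK1
    exact lt_irrefl _ hK1
  | gK_mid_sqrt K _ hK0 hK1 ha => exact sqrt' he hK1 ha
  | g0 _ ha =>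
    exact ⟨he.isTypeOf_gK hg ha (by positivity) (by simp),
      sqrt he ha (by positivity) (by ring)⟩
  | gK_neg_opp K _ _ hK ha hb h => exact ⟨he.isTypeOf_gK hg ha hb h, opp he⟩
  | gK_neg_sqrt K _ hK ha => exact sqrt' he (by linarith) ha
  | gI _ ha =>
    exact ⟨he.hasBracketBasis hg (x := a⁻¹) (y := 1) (by positivity) one_ne_zero (by field_simp)
      (by simp) (by simp), opp (b := 0) (by simpa using he)⟩
  | e11 _ hb =>
    exact ⟨he.hasBracketBasis hg (x := b⁻¹) (y := 1) (by positivity) one_ne_zero (by simp)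
      (by field_simp) (by field_simp), symm he hb hb.ne⟩
  | heisenberg _ hb =>
    refine ⟨he.hasBracketBasis hg (x := b⁻¹) (y := 1) (by positivity) one_ne_zero (by simp)
      (by field_simp) (by simp), ?_⟩
    -- Here bc = 0 = a², so the central vector is -b e₂, which is rescaled to e₂.
    have := symmetrySubspace_of_mul_eq hg he hb hb.ne' (by simp)
    rw [zero_smul, zero_sub, ← neg_smul,
      Submodule.span_singleton_smul_eq (IsUnit.mk0 _ (neg_ne_zero.2 hb.ne'))] at this
    exact ⟨this, indexOfSymmetry_of_eq_span h2 this⟩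
  | e2 _ hb =>
    exact ⟨he.hasBracketBasis hg (x := b⁻¹) (y := 1) (by positivity) one_ne_zero (by simp)
      (by field_simp) (by field_simp), opp he⟩
  | abelian =>
    exact ⟨he.hasBracketBasis hg (x := 1) (y := 1) one_ne_zero one_ne_zero (by simp)
      (by simp) (by simp), opp (b := 0) (by simpa using he)⟩

theorem exists_tableRow {V : Type*} [AddCommGroup V] [Module ℝ V] (e : Fin 3 → V)
    (ha : 0 ≤ a) (hcb : |c| ≤ b) (h : b = c ∨ b + c = 0 ∨ b + c = 2 * a ∨ b * c = a ^ 2) :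
    ∃ (t : AlgebraType) (S : Submodule ℝ V) (i : ℕ), TableRow e t a b c S i := by
  have hb : 0 ≤ b := (abs_nonneg c).trans hcb
  have hcb' := le_of_abs_le hcb
  by_cases hbc : b = c
  · subst hbc
    rcases hb.eq_or_lt with rfl | hb
    · rcases ha.eq_or_lt with rfl | ha
      · exact ⟨_, _, _, .abelian⟩
      · exact ⟨_, _, _, .gI a ha⟩
    · rcases ha.eq_or_lt with rfl | ha
      · exact ⟨_, _, _, .e11 b hb⟩
      · rcases lt_trichotomy (b * b / a ^ 2) 1 with h | h | h
        · exact ⟨_, _, _, .gK_mid_eq _ a b (by positivity) h ha hb rfl⟩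
        · exact ⟨_, _, _, .g1_eq a b ha hb h⟩
        · exact ⟨_, _, _, .gK_gt_one _ a b h ha hb rfl⟩
  replace hb : 0 < b := lt_of_le_of_ne hb fun h0 => hbc (by
    subst h0
    exact (abs_eq_zero.1 (le_antisymm hcb (abs_nonneg c))).symm)
  rcases ha.eq_or_lt with rfl | ha
  · have : c = 0 ∨ c = -b := by
      rcases h with h | h | h | h
      · exact absurd h hbc
      · exact .inr (by linarith)
      · exact .inr (by linarith)
      · exact .inl (by simpa [hb.ne'] using h)
    rcases this with rfl | rfl
    · exact ⟨_, _, _, .heisenberg b hb⟩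
    · exact ⟨_, _, _, .e2 b hb⟩
  rcases h with h | h | h | h
  · exact absurd h hbc
  · obtain rfl : c = -b := by linarith
    exact ⟨_, _, _, .gK_neg_opp _ a b (div_neg_of_neg_of_pos (by nlinarith) (by positivity)) ha hb
      rfl⟩
  · have hlt : a < b := by
      have : c < b := lt_of_le_of_ne hcb' (Ne.symm hbc)
      linarith
    -- This is bc/a², since b + c = 2a gives bc = a² - (b - a)².
    let K : ℝ := 1 - ((b - a) / a) ^ 2
    have hs : √(1 - K) = (b - a) / a := by
      rw [sub_sub_cancel]
      exact Real.sqrt_sq (div_nonneg (by linarith) ha.le)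
    have hb' : a + a * √(1 - K) = b := by rw [hs]; field_simp; ring
    have hc' : a - a * √(1 - K) = c := by rw [hs]; field_simp; linarith
    have hK1 : K < 1 := sub_lt_self _ (pow_pos (div_pos (by linarith) ha) 2)
    rcases lt_trichotomy K 0 with hK | hK | hK
    · have := TableRow.gK_neg_sqrt (e := e) K a hK ha
      rw [hb', hc'] at this
      exact ⟨_, _, _, this⟩
    · rw [hK, sub_zero, Real.sqrt_one, mul_one] at hb' hc'
      obtain rfl : b = 2 * a := by linarith
      obtain rfl : c = 0 := by linarith
      exact ⟨_, _, _, .g0 a ha⟩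
    · have := TableRow.gK_mid_sqrt (e := e) K a hK hK1 ha
      rw [hb', hc'] at this
      exact ⟨_, _, _, this⟩
  · exact ⟨_, _, _, .g1_ne a b c ha hb hbc (by rw [h]; exact div_self (by positivity))⟩

end Table

end SymIndex

end

theorem mainTheorem1 {G : Type*} [TopologicalSpace G] [T2Space G]
    [ChartedSpace (EuclideanSpace ℝ (Fin 3)) G] [Group G] [LieGroup (𝓡 3) ∞ G]
    [SimplyConnectedSpace G] (g : SymIndex.SmoothMetric 3 G) (hg : SymIndex.IsLeftInvariant g)
    (e : Fin 3 → GroupLieAlgebra (𝓡 3) G) (a b c : ℝ) (he : SymIndex.DefinesTriple g e a b c) :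
    (∀ (t : SymIndex.AlgebraType) (S : Submodule ℝ (GroupLieAlgebra (𝓡 3) G)) (i : ℕ),
      SymIndex.TableRow e t a b c S i →
        t.IsTypeOf (GroupLieAlgebra (𝓡 3) G) ∧
          SymIndex.symmetrySubspace g (1 : G) = S ∧ SymIndex.indexOfSymmetry g = i) ∧
    ((¬ ∃ (t : SymIndex.AlgebraType) (S : Submodule ℝ (GroupLieAlgebra (𝓡 3) G)) (i : ℕ),
      SymIndex.TableRow e t a b c S i) →
        SymIndex.symmetrySubspace g (1 : G) = ⊥ ∧ SymIndex.indexOfSymmetry g = 0) := by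
  refine ⟨fun t S i h => SymIndex.symmetrySubspace_of_tableRow hg he h, fun h => ?_⟩
  have hno := mt (SymIndex.exists_tableRow e he.a_nonneg he.abs_le) h
  simp only [not_or] at hno
  have := SymIndex.symmetrySubspace_eq_bot hg he hno.1 hno.2.1 hno.2.2.1 hno.2.2.2
  exact ⟨this, SymIndex.indexOfSymmetry_of_eq_bot this⟩
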